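/- Let $F$ be a field of characteristic $p$, where $p=\infty$ if the characteristic is zero, and let $n\ge s\ge 1$ be integers. **Descent algebras.** For a composition $q=(q_1,\dots,q_k)$ of $m\ge 0$ let $\mathfrak S_q\le\mathfrak S_m$ be its Young subgroup, let $\Xi^q\in F\mathfrak S_m$ be the sum of the minimal length representatives of the right cosets of $\mathfrak S_q$ in $\mathfrak S_m$ (permutations are composed from left to right), and let $\mathscr D_m(F)$ be the $F$-span of all $\Xi^q$, which is a subalgebra of $F\mathfrak S_m$ with basis $\{\Xi^q\}$. Let $\varphi^q(\sigma)$ be the number of right cosets of $\mathfrak S_q$ fixed by $\sigma\in\mathfrak S_m$, and let $\theta$ be the $F$-linear map from $\mathscr D_m(F)$ to the $F$-valued functions on $\mathfrak S_m$ with $\theta(\Xi^q)=\varphi^q\cdot 1_F$. Let $\Delta_s:\mathscr D_n(F)\to\mathscr D_{n-s}(F)$ be the $F$-linear map with $\Delta_s(\Xi^q)=\sum_{i:\,q_i\ge s}\Xi^{q^{(i)}}$, where $q^{(i)}$ is obtained from $q$ by replacing $q_i$ by $q_i-s$ and deleting this part if it is $0$. **Partitions.** Partitions $\lambda,\mu$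 of $m$ are $p$-equivalent, $\lambda\sim_p\mu$, if the $p'$-parts of any permutations of cycle types $\lambda$ and $\mu$ are conjugate in $\mathfrak S_m$ (for $p=\infty$ this means $\lambda=\mu$). A partition is $p$-regular if each part occurs at most $p-1$ times; $\Lambda^+_p(m)$ is the set of $p$-regular partitions of $m$, and it contains exactly one member of each $p$-equivalence class. For $\lambda\in\Lambda_p^+(m)$ let $\mathrm{char}_\lambda$ be the characteristic function (with values in $F$) of the set of all $\sigma\in\mathfrak S_m$ whose cycle type is $p$-equivalent to $\lambda$. For $\mu\in\Lambda^+_p(n-s)$ let $\mu^{\#s}\in\Lambda^+_p(n)$ be the $p$-regular partition that is $p$-equivalent to the partition obtained from $\mu$ by adjoining a part $s$, and let $\Upsilon=\{\mu^{\#s}:\mu\in\Lambda_p^+(n-s)\}$. A complete set of primitive orthogonal idempotents of an algebra is a finite family of pairwise orthogonal primitive idempotents with sum $1$. **Lemma.** Let $\{e_\lambda:\lambda\in\Lambda_p^+(n)\}$ be a complete set of primitive orthogonal idempotents of $\mathscr D_n(F)$ such that $\theta(e_\lambda)=\mathrm{char}_\lambda$ for all $\lambda\in\Lambda_p^+(n)$.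 Then $\Delta_s(e_\lambda)=0$ if $\lambda\notin\Upsilon$; the family $\{\Delta_s(e_\lambda):\lambda\in\Upsilon\}$ is a complete set of primitive orthogonal idempotents of $\mathscr D_{n-s}(F)$, in particular $\sum_{\lambda\in\Upsilon}\Delta_s(e_\lambda)=1$; and $\theta(\Delta_s(e_\lambda))=\mathrm{char}_\mu$ whenever $\mu\in\Lambda_p^+(n-s)$ and $\lambda=\mu^{\#s}$. -/

import Mathlib

namespace DescentAlgebra

open Equiv MulOpposite

/-- The Coxeter length of a permutation of `{0, …, n - 1}`: its number of inversions. -/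
def inversions {n : ℕ} (g : Perm (Fin n)) : ℕ :=
  (Finset.univ.filter fun x : Fin n × Fin n => x.1 < x.2 ∧ g x.2 < g x.1).card

/-- The Young subgroup of a composition `q`: the permutations that preserve each of the
consecutive intervals (blocks) of lengths `q₁, q₂, …`. -/
def youngSubgroup {n : ℕ} (q : Composition n) : Subgroup (Perm (Fin n)) where
  carrier := {h | ∀ i, q.index (h i) = q.index i}
  mul_mem' := fun {a b} ha hb i => (ha (b i)).trans (hb i)
  one_mem' := fun _ => rfl
  inv_mem' := fun {a} ha i => by
    have := ha (a⁻¹ i)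
    simpa using this.symm

/-- `g` has minimal length in its coset of the Young subgroup of `q`. Mathlib's product
`g * h` is `g ∘ h`; this is the product `h g` when permutations are composed from left to right,
so the coset is the *right* coset of the Young subgroup for the left-to-right convention. -/
def IsMinRep {n : ℕ} (q : Composition n) (g : Perm (Fin n)) : Prop :=
  ∀ h ∈ youngSubgroup q, inversions g ≤ inversions (g * h)

/-- The group algebra of the symmetric group, permutations being composed from left to right. -/
abbrev SymAlgebra (O : Type*) [CommRing O] (n : ℕ) : Type _ :=
  MonoidAlgebra O (Perm (Fin n))ᵐᵒᵖ

open Classical in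
/-- `Ξ^q`: the sum of the minimal length representatives of the right cosets of the Young
subgroup of `q`. -/
noncomputable def Xi (O : Type*) [CommRing O] {n : ℕ} (q : Composition n) : SymAlgebra O n :=
  ∑ g : Perm (Fin n) with IsMinRep q g, MonoidAlgebra.of O (Perm (Fin n))ᵐᵒᵖ (op g)

/-! ### The span of the `Ξ^q` is a subalgebra and the `Ξ^q` are linearly independent -/

/-- `g` is increasing on the fibres of `m`. -/
def FibInc {n : ℕ} {α : Type*} (m : Fin n → α) (g : Perm (Fin n)) : Prop :=
  ∀ i j, i < j → m i = m j → g i < g j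

theorem index_monotone {n : ℕ} (q : Composition n) : Monotone q.index := by
  intro i j hij
  by_contra! h
  have h1 := q.lt_sizeUpTo_index_succ j
  have h2 := q.sizeUpTo_index_le i
  have h3 : q.sizeUpTo (q.index j).succ ≤ q.sizeUpTo (q.index i) :=
    q.monotone_sizeUpTo (by simpa using h)
  have h4 : (i : ℕ) ≤ j := hij
  omega

theorem FibInc.inversion_lt {n : ℕ} {q : Composition n} {g : Perm (Fin n)}
    (hg : FibInc q.index g) {i j : Fin n} (hij : i < j) (h : g j < g i) :
    q.index i < q.index j :=
  lt_of_le_of_ne (index_monotone q hij.le) fun e => (hg i j hij e).not_gt h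

theorem isMinRep_iff {n : ℕ} (q : Composition n) (g : Perm (Fin n)) :
    IsMinRep q g ↔ FibInc q.index g := by
  constructor
  · intro hg
    by_contra hn
    simp only [FibInc, not_forall] at hn
    obtain ⟨a, b, hab, hq, hgab⟩ := hn
    let f : Fin n → Fin q.length ×ₗ Fin n := fun i => toLex (q.index i, g i)
    let h := Tuple.sort f
    have hmono : Monotone (f ∘ h) := Tuple.monotone_sort f
    have h1 : q.index ∘ h = q.index := by
      have : Monotone (q.index ∘ h) := by
        intro i j hij
        have := hmono hij
        simp only [f, Function.comp, Prod.Lex.le_iff] at this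
        rcases this with h | h
        · exact le_of_lt h
        · exact le_of_eq h.1
      have := Tuple.unique_monotone (f := q.index) (σ := h) (τ := 1) this
        (by simpa using index_monotone q)
      simpa using this
    have hY : h ∈ youngSubgroup q := fun i => congrFun h1 i
    have hinc : FibInc q.index (g * h) := by
      intro i j hij e
      have := hmono hij.le
      simp only [f, Function.comp, Prod.Lex.le_iff] at this
      have e' : q.index (h i) = q.index (h j) := by rw [hY i, hY j, e]
      rcases this with h' | h'
      · exact absurd e' h'.ne
      · refine lt_of_le_of_ne h'.2 fun e2 => hij.ne ?_
        exact (g * h).injective e2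
    refine (hg h hY).not_gt ?_
    unfold inversions
    let F : Fin n × Fin n ↪ Fin n × Fin n :=
      ⟨fun x => (h x.1, h x.2), fun x y hxy => by
        simp only [Prod.mk.injEq, EmbeddingLike.apply_eq_iff_eq] at hxy
        exact Prod.ext hxy.1 hxy.2⟩
    rw [← Finset.card_map F]
    apply Finset.card_lt_card
    rw [Finset.ssubset_iff_of_subset]
    · refine ⟨(a, b), ?_, ?_⟩
      · simp only [Finset.mem_filter, Finset.mem_univ, true_and]
        refine ⟨hab, lt_of_le_of_ne (not_lt.1 hgab) fun e => hab.ne ?_⟩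
        exact (g.injective e).symm
      · simp only [Finset.mem_map, Finset.mem_filter, Finset.mem_univ, true_and, not_exists,
          not_and]
        rintro ⟨i, j⟩ ⟨hij, hg'⟩ e
        have hlt := hinc.inversion_lt hij hg'
        change (h i, h j) = _ at e
        rw [Prod.mk.injEq] at e
        rw [← hY i, ← hY j, e.1, e.2, hq] at hlt
        exact lt_irrefl _ hlt
    · rintro ⟨x, y⟩
      simp only [Finset.mem_map, Finset.mem_filter, Finset.mem_univ, true_and]
      rintro ⟨⟨i, j⟩, ⟨hij, hg'⟩, e⟩
      have hlt := hinc.inversion_lt hij hg'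
      change (h i, h j) = _ at e
      rw [Prod.mk.injEq] at e
      rw [← hY i, ← hY j, e.1, e.2] at hlt
      obtain ⟨rfl, rfl⟩ := e
      exact ⟨(index_monotone q).reflect_lt hlt, hg'⟩
  · intro hg h hh
    have hh' : ∀ i, q.index (h⁻¹ i) = q.index i := inv_mem hh
    refine Finset.card_le_card_of_injOn (fun x => (h⁻¹ x.1, h⁻¹ x.2)) ?_ ?_
    · rintro ⟨i, j⟩ hx
      simp only [Finset.coe_filter, Finset.mem_univ, true_and, Set.mem_ofPred_eq] at hx ⊢
      have := hg.inversion_lt hx.1 hx.2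
      rw [← hh' i, ← hh' j] at this
      exact ⟨(index_monotone q).reflect_lt this, by simpa using hx.2⟩
    · rintro ⟨i, j⟩ - ⟨i', j'⟩ - e
      simpa using e

theorem mem_boundaries_iff {n : ℕ} (q : Composition n) {i j : Fin n} (hij : (i : ℕ) + 1 = j)
    : j.castSucc ∈ q.boundaries ↔ q.index i ≠ q.index j := by
  have hi1 := q.lt_sizeUpTo_index_succ i
  have hi2 := q.sizeUpTo_index_le i
  have hj1 := q.lt_sizeUpTo_index_succ j
  have hj2 := q.sizeUpTo_index_le j
  have key : ∀ {a b : ℕ}, q.sizeUpTo a < q.sizeUpTo b → a < b :=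
    fun h => q.monotone_sizeUpTo.reflect_lt h
  simp only [Composition.boundaries, Finset.mem_map, Finset.mem_univ, true_and]
  constructor
  · rintro ⟨t, ht⟩ e
    have ht' : q.sizeUpTo t = j := by
      have := congrArg Fin.val ht
      simpa [Composition.boundary] using this
    have h1 : (q.index i : ℕ) < t := key (by omega)
    have h2 : (t : ℕ) < (q.index j).succ := key (by omega)
    simp only [Fin.val_succ] at h2
    rw [e] at h1
    omega
  · intro hne
    have hlt : q.index i < q.index j :=
      lt_of_le_of_ne (index_monotone q (by rw [Fin.le_def]; omega)) hne
    refine ⟨(q.index j).castSucc, ?_⟩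
    have h3 : q.sizeUpTo (q.index i).succ ≤ q.sizeUpTo (q.index j) :=
      q.monotone_sizeUpTo (by simpa using hlt)
    apply Fin.ext
    change q.sizeUpTo (q.index j) = (j : ℕ)
    omega

theorem monotone_eq_of_adjacent {n : ℕ} {α β : Type*} [PartialOrder α]
    {m : Fin n → α} (hm : Monotone m) {k : Fin n → β}
    (h : ∀ i j : Fin n, (i : ℕ) + 1 = j → m i = m j → k i = k j) {i j : Fin n}
    (e : m i = m j) : k i = k j := by
  wlog hij : i ≤ j generalizing i j
  · exact (this e.symm (le_of_not_ge hij)).symm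
  obtain ⟨d, hd⟩ := Nat.exists_eq_add_of_le (Fin.le_def.1 hij)
  induction d generalizing j with
  | zero => rw [Fin.ext (a := j) (b := i) (by omega)]
  | succ d ih =>
    let j' : Fin n := ⟨i + d, by omega⟩
    have h1 : i ≤ j' := by rw [Fin.le_def]; simp [j']
    have h2 : j' ≤ j := by rw [Fin.le_def]; simp [j']; omega
    have e1 : m i = m j' := le_antisymm (hm h1) (by rw [e]; exact hm h2)
    exact (ih e1 h1 rfl).trans (h j' j (by simp [j']; omega) (by rw [← e1, e]))

theorem exists_index_eq {n : ℕ} {α : Type*} [PartialOrder α] {m : Fin n → α} (hm : Monotone m) :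
    ∃ q : Composition n, ∀ i j, q.index i = q.index j ↔ m i = m j := by
  classical
  let c : CompositionAsSet n :=
    { boundaries := Finset.univ.filter fun k => k = 0 ∨ k = Fin.last n ∨
        ∃ i j : Fin n, (i : ℕ) + 1 = j ∧ j.castSucc = k ∧ m i ≠ m j
      zero_mem := by simp
      getLast_mem := by simp }
  refine ⟨c.toComposition, ?_⟩
  have hadj : ∀ i j : Fin n, (i : ℕ) + 1 = j →
      (c.toComposition.index i = c.toComposition.index j ↔ m i = m j) := by
    intro i j hij
    rw [← not_iff_not, ← ne_eq, ← mem_boundaries_iff _ hij, c.toComposition_boundaries]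
    simp only [c, Finset.mem_filter, Finset.mem_univ, true_and]
    constructor
    · rintro (h | h | ⟨i', j', h1, h2, h3⟩)
      · have := congrArg Fin.val h
        simp at this; omega
      · have := congrArg Fin.val h
        simp at this; omega
      · have hj : j' = j := Fin.castSucc_injective _ h2
        subst hj
        have hi : i' = i := Fin.ext (by omega)
        subst hi
        exact h3
    · intro h
      exact Or.inr (Or.inr ⟨i, j, hij, rfl, h⟩)
  intro i j
  exact ⟨monotone_eq_of_adjacent (index_monotone _) fun a b hab => (hadj a b hab).1,
    monotone_eq_of_adjacent hm fun a b hab => (hadj a b hab).2⟩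

open Classical in
theorem Xi_eq (O : Type*) [CommRing O] {n : ℕ} (q : Composition n) :
    Xi O q = ∑ g : Perm (Fin n) with FibInc q.index g,
      MonoidAlgebra.of O (Perm (Fin n))ᵐᵒᵖ (op g) := by
  simp only [Xi, isMinRep_iff]

open Classical in
theorem sum_fibInc_mem (O : Type*) [CommRing O] {n : ℕ} {α : Type*} [PartialOrder α]
    {m : Fin n → α} (hm : Monotone m) :
    ∑ g : Perm (Fin n) with FibInc m g, MonoidAlgebra.of O (Perm (Fin n))ᵐᵒᵖ (op g) ∈
      Submodule.span O (Set.range (Xi O : Composition n → SymAlgebra O n)) := by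
  obtain ⟨q, hq⟩ := exists_index_eq hm
  have : ∀ g : Perm (Fin n), FibInc m g ↔ FibInc q.index g := fun g => by
    simp only [FibInc, hq]
  simp only [this, ← Xi_eq]
  exact Submodule.subset_span ⟨q, rfl⟩

/-- The pair of block indices attached to a position by `g`. -/
def pairWord {n : ℕ} (r q : Composition n) (g : Perm (Fin n)) :
    Fin n → Fin r.length ×ₗ Fin q.length :=
  fun i => toLex (r.index i, q.index (g i))

theorem pairWord_monotone {n : ℕ} (r q : Composition n) {g : Perm (Fin n)}
    (hg : FibInc r.index g) : Monotone (pairWord r q g) := by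
  intro i j hij
  rcases hij.eq_or_lt with rfl | hij
  · exact le_rfl
  simp only [pairWord, Prod.Lex.le_iff, ofLex_toLex]
  rcases (index_monotone r hij.le).eq_or_lt with h | h
  · exact Or.inr ⟨h, index_monotone q (hg i j hij h).le⟩
  · exact Or.inl h

theorem sort_eq_of {n : ℕ} (q : Composition n) {h : Perm (Fin n)} (hh : FibInc q.index h) :
    h = Tuple.sort (q.index ∘ (h⁻¹ : Perm (Fin n))) := by
  rw [Tuple.eq_sort_iff]
  refine ⟨?_, ?_⟩
  · have : (q.index ∘ ⇑h⁻¹) ∘ ⇑h = q.index := by ext i; simp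
    rw [this]; exact index_monotone q
  · intro i j hij e
    exact hh i j hij (by simpa using e)

open Classical in
theorem Xi_mul_Xi (O : Type*) [CommRing O] {n : ℕ} (r q : Composition n) :
    Xi O r * Xi O q = ∑ m ∈ (Finset.univ.filter (FibInc r.index)).image (pairWord r q),
      ∑ w : Perm (Fin n) with FibInc m w, MonoidAlgebra.of O (Perm (Fin n))ᵐᵒᵖ (op w) := by
  rw [Xi_eq, Xi_eq, Finset.sum_mul_sum, ← Finset.sum_product', Finset.sum_sigma']
  refine Finset.sum_bij (fun x _ => ⟨pairWord r q x.1, x.2 * x.1⟩) ?_ ?_ ?_ ?_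
  · rintro ⟨g, h⟩ hx
    simp only [Finset.mem_product, Finset.mem_filter, Finset.mem_univ, true_and,
      Finset.mem_sigma, Finset.mem_image] at hx ⊢
    refine ⟨⟨g, hx.1, rfl⟩, ?_⟩
    intro i j hij e
    simp only [pairWord, EmbeddingLike.apply_eq_iff_eq, Prod.mk.injEq] at e
    exact hx.2 _ _ (hx.1 i j hij e.1) e.2
  · rintro ⟨g, h⟩ hx ⟨g', h'⟩ hx' e
    simp only [Finset.mem_product, Finset.mem_filter, Finset.mem_univ, true_and] at hx hx'
    simp only [Sigma.mk.injEq, heq_eq_eq] at e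
    obtain ⟨e1, e2⟩ := e
    have e3 : q.index ∘ g = q.index ∘ g' := by
      funext i
      have := congrFun e1 i
      simp only [pairWord, EmbeddingLike.apply_eq_iff_eq, Prod.mk.injEq] at this
      exact this.2
    have e4 : q.index ∘ (h⁻¹ : Perm (Fin n)) = q.index ∘ (h'⁻¹ : Perm (Fin n)) := by
      funext x
      have := congrFun e3 ((h * g)⁻¹ x)
      have h2 : g' ((h * g)⁻¹ x) = h'⁻¹ x := by rw [e2]; simp
      simp only [Function.comp, h2] at this
      simpa using this
    have e5 : h = h' := by rw [sort_eq_of q hx.2, sort_eq_of q hx'.2, e4]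
    subst e5
    have : g = g' := mul_left_cancel e2
    rw [this]
  · rintro ⟨m, w⟩ hx
    simp only [Finset.mem_filter, Finset.mem_univ, true_and,
      Finset.mem_sigma, Finset.mem_image] at hx
    obtain ⟨⟨g0, hg0, rfl⟩, hw⟩ := hx
    have hmono := pairWord_monotone r q hg0
    let d : Fin n → Fin q.length := fun x => q.index (g0 (w⁻¹ x))
    let h := Tuple.sort d
    have hd : d ∘ h = q.index := by
      have h1 : d ∘ (w * g0⁻¹ : Perm (Fin n)) = q.index := by ext i; simp [d]
      rw [← h1]
      symm
      rw [Tuple.comp_sort_eq_comp_iff_monotone, h1]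
      exact index_monotone q
    have hdh : ∀ x, q.index x = d (h x) := fun x => (congrFun hd x).symm
    have hh : FibInc q.index h := by
      intro i j hij e
      exact ((Tuple.eq_sort_iff (f := d) (σ := h)).1 rfl).2 i j hij (by rw [← hdh, ← hdh, e])
    have hqg : ∀ i, q.index ((h⁻¹ * w) i) = q.index (g0 i) := by
      intro i
      rw [hdh]
      simp [d]
    refine ⟨(h⁻¹ * w, h), ?_, ?_⟩
    · simp only [Finset.mem_product, Finset.mem_filter, Finset.mem_univ, true_and]
      refine ⟨?_, hh⟩
      intro i j hij e
      have h1 := hmono hij.le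
      simp only [pairWord, Prod.Lex.le_iff, ofLex_toLex] at h1
      rcases h1 with h1 | h1
      · exact absurd e h1.ne
      · rcases h1.2.eq_or_lt with h2 | h2
        · have h3 : w i < w j := hw i j hij (by simp [pairWord, e, h2])
          by_contra hcon
          rcases (not_lt.1 hcon).eq_or_lt with h4 | h4
          · exact hij.ne ((h⁻¹ * w).injective h4).symm
          · have := hh _ _ h4 (by rw [hqg, hqg, h2])
            simp at this
            exact lt_asymm this h3
        · rw [← hqg i, ← hqg j] at h2
          exact (index_monotone q).reflect_lt h2
    · simp only [Sigma.mk.injEq, heq_eq_eq, mul_inv_cancel_left, and_true]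
      funext i
      simp only [pairWord, hqg]
  · rintro ⟨g, h⟩ -
    rw [← map_mul, ← op_mul]

theorem one_eq_sum_fibInc (n : ℕ) (w : Perm (Fin n)) :
    FibInc (fun _ : Fin n => ()) w ↔ w = 1 := by
  constructor
  · intro h
    have h1 : StrictMono w := fun i j hij => h i j hij rfl
    ext i
    have h2 : StrictMono (w⁻¹ : Perm (Fin n)) := by
      intro i j hij
      by_contra hc
      have := h1.monotone (not_lt.1 hc)
      simp at this
      exact this.not_gt hij
    have := Subsingleton.elim (w.toOrderIso h1.monotone h2.monotone) (OrderIso.refl _)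
    exact congrArg (fun f : Fin n ≃o Fin n => (f i : ℕ)) this
  · rintro rfl i j hij -
    exact hij

/-- The descent algebra: the linear span of the `Ξ^q` in the group algebra. It is closed under
multiplication. -/
noncomputable def Des (O : Type*) [CommRing O] (n : ℕ) : Subalgebra O (SymAlgebra O n) :=
  (Submodule.span O (Set.range (Xi O : Composition n → SymAlgebra O n))).toSubalgebra
    (by
      classical
      have h := sum_fibInc_mem O (m := fun _ : Fin n => ()) monotone_const
      simp only [one_eq_sum_fibInc, Finset.filter_eq', Finset.mem_univ, if_true,
        Finset.sum_singleton, op_one, map_one] at h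
      exact h)
    (by
      classical
      intro x y hx hy
      induction hx using Submodule.span_induction with
      | zero => rw [zero_mul]; exact zero_mem _
      | add a b _ _ ha hb => rw [add_mul]; exact add_mem ha hb
      | smul c a _ ha => rw [smul_mul_assoc]; exact Submodule.smul_mem _ _ ha
      | mem x hx =>
        obtain ⟨r, rfl⟩ := hx
        induction hy using Submodule.span_induction with
        | zero => rw [mul_zero]; exact zero_mem _
        | add a b _ _ ha hb => rw [mul_add]; exact add_mem ha hb
        | smul c a _ ha => rw [mul_smul_comm]; exact Submodule.smul_mem _ _ ha
        | mem y hy =>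
          obtain ⟨q, rfl⟩ := hy
          rw [Xi_mul_Xi]
          refine Submodule.sum_mem _ fun m hm => ?_
          simp only [Finset.mem_image, Finset.mem_filter, Finset.mem_univ, true_and] at hm
          obtain ⟨g, hg, rfl⟩ := hm
          exact sum_fibInc_mem O (pairWord_monotone r q hg))

theorem Xi_mem_Des (O : Type*) [CommRing O] {n : ℕ} (q : Composition n) : Xi O q ∈ Des O n :=
  Submodule.subset_span ⟨q, rfl⟩

theorem boundaries_subset {n : ℕ} {q r : Composition n}
    (h : ∀ i j, r.index i = r.index j → q.index i = q.index j) :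
    q.boundaries ⊆ r.boundaries := by
  intro k hk
  by_cases h0 : k = 0
  · subst h0
    exact r.toCompositionAsSet.zero_mem
  by_cases hl : k = Fin.last n
  · subst hl
    exact r.toCompositionAsSet.getLast_mem
  have hkn : (k : ℕ) < n := lt_of_le_of_ne (Nat.lt_succ_iff.1 k.2) fun e => hl (Fin.ext e)
  have hk0 : (k : ℕ) ≠ 0 := fun e => h0 (Fin.ext e)
  let j : Fin n := ⟨k, hkn⟩
  let i : Fin n := ⟨k - 1, by omega⟩
  have hij : (i : ℕ) + 1 = j := by simp [i, j]; omega
  have hj : j.castSucc = k := rfl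
  rw [← hj, mem_boundaries_iff _ hij] at hk ⊢
  exact fun e => hk (h i j e)

/-- A permutation which is increasing on the blocks of `q`, with descents at all block ends. -/
theorem exists_descents {n : ℕ} (q : Composition n) :
    ∃ w : Perm (Fin n), FibInc q.index w ∧
      ∀ i j, i < j → w i < w j → q.index i = q.index j := by
  let f : Fin n → (Fin q.length)ᵒᵈ := fun i => OrderDual.toDual (q.index i)
  obtain ⟨h1, h2⟩ := (Tuple.eq_sort_iff (f := f) (σ := Tuple.sort f)).1 rfl
  refine ⟨(Tuple.sort f)⁻¹, ?_, ?_⟩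
  · intro i j hij e
    by_contra hc
    rcases (not_lt.1 hc).eq_or_lt with h | h
    · exact hij.ne ((Tuple.sort f)⁻¹.injective h).symm
    · have := h2 _ _ h (by simp [f, e])
      simp at this
      exact lt_asymm this hij
  · intro i j hij hw
    have := h1 hw.le
    simp [f] at this
    exact le_antisymm (index_monotone q hij.le) this

theorem Xi_linearIndependent (O : Type*) [CommRing O] (n : ℕ) :
    LinearIndependent O (Xi O : Composition n → SymAlgebra O n) := by
  classical
  rw [Fintype.linearIndependent_iff]
  intro a ha
  have main : ∀ k, ∀ q : Composition n, n - q.length = k → a q = 0 := by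
    intro k
    induction k using Nat.strong_induction_on with
    | _ k ih =>
      intro q hq
      obtain ⟨w, hw1, hw2⟩ := exists_descents q
      have hcoef : ∀ r : Composition n, (Xi O r).coeff (op w) = if FibInc r.index w then 1 else 0 := by
        intro r
        rw [Xi_eq]
        simp only [MonoidAlgebra.coeff_sum, MonoidAlgebra.of_apply, MonoidAlgebra.coeff_single,
          Finsupp.finsetSum_apply, Finsupp.single_apply, op_inj]
        rw [Finset.sum_ite_eq' _ w]
        simp
      have h0 : ∑ r, a r * (if FibInc r.index w then 1 else 0) = 0 := by
        have := congrArg (fun x : SymAlgebra O n => x.coeff (op w)) ha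
        simpa only [MonoidAlgebra.coeff_sum, MonoidAlgebra.coeff_smul, Finsupp.coe_finsetSum,
          Finset.sum_apply, Finsupp.smul_apply, hcoef, smul_eq_mul, MonoidAlgebra.coeff_zero,
          Finsupp.coe_zero, Pi.zero_apply] using this
      rw [Finset.sum_eq_single q] at h0
      · simpa [hw1] using h0
      · intro r _ hrq
        split_ifs with hr
        · have hsub : q.boundaries ⊆ r.boundaries := boundaries_subset fun i j e => by
            rcases lt_trichotomy i j with h | h | h
            · exact hw2 i j h (hr i j h e)
            · rw [h]
            · exact (hw2 j i h (hr j i h e.symm)).symm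
          have hlt : q.boundaries.card < r.boundaries.card := by
            apply Finset.card_lt_card
            refine lt_of_le_of_ne hsub fun e => hrq ?_
            apply (compositionEquiv n).injective
            exact CompositionAsSet.ext e.symm
          rw [q.card_boundaries_eq_succ_length, r.card_boundaries_eq_succ_length] at hlt
          have := r.length_le
          rw [ih (n - r.length) (by omega) r rfl, zero_mul]
        · rw [mul_zero]
      · simp
  exact fun q => main _ q rfl

/-- The basis `Ξ^q` of the descent algebra, `q` running over the compositions of `n`. -/
noncomputable def desBasis (O : Type*) [CommRing O] (n : ℕ) :
    Module.Basis (Composition n) O (Des O n) :=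
  Module.Basis.span (Xi_linearIndependent O n)

theorem desBasis_apply (O : Type*) [CommRing O] {n : ℕ} (q : Composition n) :
    (desBasis O n q : SymAlgebra O n) = Xi O q :=
  congrArg Subtype.val (Module.Basis.span_apply (Xi_linearIndependent O n) q)

/-! ### The map `Δ_s` -/

theorem sum_set_sub {l : List ℕ} {i s : ℕ} (hi : i < l.length) (h : s ≤ l[i]) :
    (l.set i (l[i] - s)).sum = l.sum - s := by
  induction l generalizing i with
  | nil => simp at hi
  | cons a l ih =>
    cases i with
    | zero => simp at h ⊢; omega
    | succ i =>
      simp only [List.length_cons, Nat.add_lt_add_iff_right, List.getElem_cons_succ] at hi h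
      have h1 := ih hi h
      have h2 : l[i] ≤ l.sum := List.le_sum_of_mem (List.getElem_mem hi)
      simp only [List.getElem_cons_succ, List.set_cons_succ, List.sum_cons, h1]
      omega

/-- The composition `q^{(i)}` of `n - s`: subtract `s` from the `i`-th part of `q`, and delete
that part if it becomes zero. -/
def subPart {n : ℕ} (q : Composition n) (s : ℕ) (i : Fin q.length) (h : s ≤ q.blocksFun i) :
    Composition (n - s) where
  blocks := (q.blocks.set i (q.blocksFun i - s)).filter (0 < ·)
  blocks_pos := fun hi => by simpa using (List.mem_filter.1 hi).2
  blocks_sum := by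
    have h0 : ∀ l : List ℕ, (l.filter (0 < ·)).sum = l.sum := by
      intro l
      induction l with
      | nil => rfl
      | cons a l ih =>
        rcases Nat.eq_zero_or_pos a with rfl | ha
        · simpa using ih
        · simpa [ha] using ih
    rw [h0]
    have h1 := sum_set_sub (l := q.blocks) (i := i) (s := s) i.2 h
    rw [q.blocks_sum] at h1
    exact h1

/-- The linear map `Δ_s` from the descent algebra of degree `n` to that of degree `n - s`,
`Δ_s(Ξ^q) = ∑ Ξ^{q^{(i)}}`, the sum being over all `i` with `q_i ≥ s`. -/
noncomputable def Delta (O : Type*) [CommRing O] (n s : ℕ) : Des O n →ₗ[O] Des O (n - s) :=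
  (desBasis O n).constr O fun q =>
    ∑ i : {i : Fin q.length // s ≤ q.blocksFun i}, desBasis O (n - s) (subPart q s i.1 i.2)

/-! ### Young characters and the map `θ` -/

/-- The Young character `φ^q`: the number of cosets of the Young subgroup of `q` fixed by `σ`.
(Mathlib's left cosets `g ∘ S_q` are the right cosets for the left-to-right product.) -/
noncomputable def youngChar {n : ℕ} (q : Composition n) (σ : Perm (Fin n)) : ℕ :=
  Nat.card (MulAction.fixedBy (Perm (Fin n) ⧸ youngSubgroup q) σ)

/-- The linear map `θ` from the descent algebra to the class functions on the symmetric group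
that sends `Ξ^q` to the Young character `φ^q`. -/
noncomputable def theta (O : Type*) [CommRing O] (n : ℕ) :
    Des O n →ₗ[O] (Perm (Fin n) → O) :=
  (desBasis O n).constr O fun q σ => (youngChar q σ : O)

/-- `σ` belongs to the conjugacy class `C_lam` of the symmetric group. -/
def HasType {n : ℕ} (σ : Perm (Fin n)) (lam : n.Partition) : Prop :=
  σ.partition.parts = lam.parts

/-- `ρ` is the `p'`-part of the group element `σ`: one has `σ = u ρ = ρ u` where the order of
`u` is a power of `p` and the order of `ρ` is not divisible by `p`. Here `p` is `0` or a prime;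
for `p = 0` in a finite group this says that `ρ = σ`. -/
def IsPPrimePart {G : Type*} [Group G] (p : ℕ) (σ ρ : G) : Prop :=
  ∃ u : G, σ = u * ρ ∧ Commute u ρ ∧ (∃ k, orderOf u = p ^ k) ∧ ¬ p ∣ orderOf ρ

/-- `p`-equivalence of partitions of `n`: the `p'`-parts of permutations of the two cycle types
are conjugate in the symmetric group. -/
def PEquiv (p : ℕ) {n : ℕ} (lam mu : n.Partition) : Prop :=
  ∀ σ τ ρ π : Perm (Fin n), HasType σ lam → HasType τ mu →
    IsPPrimePart p σ ρ → IsPPrimePart p τ π → IsConj ρ π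

/-- A partition is `p`-regular if every part occurs at most `p - 1` times. The value `p = 0`
plays the role of `p = ∞`: then every partition is regular. -/
def IsPRegular (p : ℕ) {n : ℕ} (lam : n.Partition) : Prop :=
  p = 0 ∨ ∀ i, lam.parts.count i ≤ p - 1

/-! ### Every `p`-equivalence class contains a `p`-regular partition -/

theorem exists_pPrimePart_pow {p : ℕ} (hp : p.Prime ∨ p = 0) (G : Type*) [Group G] [Finite G] :
    ∃ N : ℕ, (∀ σ ρ : G, IsPPrimePart p σ ρ ↔ ρ = σ ^ N) ∧
      (p ≠ 0 → ∀ σ : G, (orderOf (σ ^ N)).Coprime p) := by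
  rcases hp with hp | rfl
  · obtain ⟨A, M, hM, hG⟩ := Nat.exists_eq_pow_mul_and_not_dvd
      (Nat.card_pos (α := G)).ne' p hp.ne_one
    have hcop : Nat.Coprime p M := (Nat.Prime.coprime_iff_not_dvd hp).2 hM
    obtain ⟨N, hN0, hN1⟩ := Nat.chineseRemainder (Nat.Coprime.pow_left A hcop) 0 1
    have hN0' : p ^ A ∣ N := (Nat.modEq_zero_iff_dvd).1 hN0
    have hM1 : ∀ σ : G, orderOf (σ ^ N) ∣ M := by
      intro σ
      apply orderOf_dvd_of_pow_eq_one
      rw [← pow_mul]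
      obtain ⟨t, rfl⟩ := hN0'
      rw [show p ^ A * t * M = (p ^ A * M) * t by ring, ← hG, pow_mul, pow_card_eq_one', one_pow]
    refine ⟨N, fun σ ρ => ⟨?_, ?_⟩, fun _ σ => (Nat.Coprime.coprime_dvd_left (hM1 σ) hcop.symm)⟩
    · rintro ⟨u, rfl, hcomm, ⟨k, hk⟩, hρ⟩
      have hu : orderOf u ∣ p ^ A := by
        have h1 : orderOf u ∣ p ^ A * M := hG ▸ orderOf_dvd_natCard u
        refine Nat.Coprime.dvd_of_dvd_mul_right ?_ h1
        rw [hk]; exact Nat.Coprime.pow_left k hcop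
      have hρ' : orderOf ρ ∣ M := by
        have h1 : orderOf ρ ∣ p ^ A * M := hG ▸ orderOf_dvd_natCard ρ
        refine Nat.Coprime.dvd_of_dvd_mul_left ?_ h1
        exact (Nat.Coprime.pow_left A ((Nat.Prime.coprime_iff_not_dvd hp).2 hρ)).symm
      rw [hcomm.mul_pow, orderOf_dvd_iff_pow_eq_one.1 (hu.trans hN0'), one_mul]
      have := (pow_eq_pow_iff_modEq (x := ρ) (n := N) (m := 1)).2 (Nat.ModEq.of_dvd hρ' hN1)
      rw [this, pow_one]
    · rintro rfl
      refine ⟨σ * (σ ^ N)⁻¹, by simp, ?_, ?_, fun h => hM (h.trans (hM1 σ))⟩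
      · exact ((Commute.refl σ).mul_left ((Commute.self_pow σ N).symm.inv_left)).pow_right N |>.trans
          rfl
      · have h1 : orderOf (σ * (σ ^ N)⁻¹) ∣ p ^ A := by
          apply orderOf_dvd_of_pow_eq_one
          rw [((Commute.self_pow σ N).inv_right).mul_pow, inv_pow, mul_inv_eq_one, ← pow_mul]
          rw [pow_eq_pow_iff_modEq]
          refine Nat.ModEq.of_dvd (hG ▸ orderOf_dvd_natCard σ : orderOf σ ∣ p ^ A * M) ?_
          rw [mul_comm N]
          simpa using (Nat.ModEq.mul_left' (p ^ A) hN1).symm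
        obtain ⟨k, -, hk⟩ := (Nat.dvd_prime_pow hp).1 h1
        exact ⟨k, hk⟩
  · refine ⟨1, fun σ ρ => ⟨?_, ?_⟩, fun h => absurd rfl h⟩
    · rintro ⟨u, rfl, -, ⟨k, hk⟩, -⟩
      have h0 := (orderOf_pos u).ne'
      have : orderOf u = 1 := by
        rcases Nat.eq_zero_or_pos k with rfl | hk0
        · simpa using hk
        · rw [zero_pow hk0.ne'] at hk
          exact absurd hk h0
      rw [orderOf_eq_one_iff.1 this]; simp
    · rintro rfl
      refine ⟨1, by simp, Commute.one_left _, ⟨0, by simp⟩, ?_⟩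
      rw [zero_dvd_iff]
      exact (orderOf_pos _).ne'

theorem isConj_pow_of_coprime {n : ℕ} (σ : Perm (Fin n)) {k : ℕ}
    (h : (orderOf σ).Coprime k) : IsConj (σ ^ k) σ := by
  induction σ using Equiv.Perm.cycle_induction_on with
  | base_one => simp
  | base_cycles σ hσ =>
    have hc : (σ ^ k).IsCycle := (hσ.pow_iff).2 h.symm
    refine hc.isConj hσ ?_
    congr 1
    rw [hσ.support_pow_eq_iff]
    intro hd
    have h1 : orderOf σ = 1 := Nat.eq_one_of_dvd_coprimes h dvd_rfl hd
    exact hσ.ne_one (orderOf_eq_one_iff.1 h1)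
  | induction_disjoint σ τ hd _ hσ hτ =>
    rw [hd.commute.mul_pow]
    rw [hd.orderOf] at h
    exact Perm.Disjoint.isConj_mul (hσ (h.coprime_dvd_left (Nat.dvd_lcm_left _ _)))
      (hτ (h.coprime_dvd_left (Nat.dvd_lcm_right _ _))) (hd.pow_disjoint_pow k k) hd

theorem cycleType_cycle_pow {n : ℕ} {c : Perm (Fin n)} (hc : c.IsCycle) {p i : ℕ} (hp : 0 < p)
    (hi : 2 ≤ i) (hs : c.support.card = p * i) :
    (c ^ p).cycleType = Multiset.replicate p i := by
  have hord : orderOf c = p * i := by rw [hc.orderOf, hs]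
  have hall : ∀ b ∈ (c ^ p).cycleType, b = i := by
    intro b hb
    obtain ⟨d, τ, e, hd, hdc, rfl⟩ := Perm.mem_cycleType_iff.1 hb
    rw [← hdc.orderOf]
    obtain ⟨x, hx, -⟩ := id hdc
    have hpow : ∀ k, ((c ^ p) ^ k) x = (d ^ k) x := by
      intro k
      rw [e, hd.commute.mul_pow, Perm.mul_apply, Perm.pow_apply_eq_self_of_apply_eq_self ((hd x).resolve_left hx)]
    have hcx : c x ≠ x := by
      intro h
      apply hx
      have := hpow 1
      rw [pow_one, pow_one, Perm.pow_apply_eq_self_of_apply_eq_self h] at this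
      exact this.symm
    apply Nat.dvd_antisymm
    · rw [orderOf_dvd_iff_pow_eq_one, hdc.pow_eq_one_iff' hx, ← hpow, ← pow_mul, ← hord,
        pow_orderOf_eq_one, Perm.one_apply]
    · have h1 : c ^ (p * orderOf d) = 1 := by
        rw [hc.pow_eq_one_iff' hcx, pow_mul, hpow, pow_orderOf_eq_one, Perm.one_apply]
      rw [← orderOf_dvd_iff_pow_eq_one, hord] at h1
      exact Nat.dvd_of_mul_dvd_mul_left hp h1
  have hrep := Multiset.eq_replicate_of_mem hall
  have hsum := (c ^ p).sum_cycleType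
  have hsupp : (c ^ p).support = c.support := by
    rw [hc.support_pow_eq_iff, hord]
    intro h
    have := Nat.le_of_dvd hp h
    nlinarith
  rw [hsupp, hs, hrep, Multiset.sum_replicate, smul_eq_mul] at hsum
  rw [hrep, Nat.eq_of_mul_eq_mul_right (by omega) hsum]

theorem hasType_iff {n : ℕ} {σ : Perm (Fin n)} {lam : n.Partition} :
    HasType σ lam ↔ σ.cycleType = lam.parts.filter (2 ≤ ·) := by
  constructor
  · intro h
    rw [← h, Perm.filter_parts_partition_eq_cycleType]
  · intro h
    have hsplit := Multiset.filter_add_not (2 ≤ ·) lam.parts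
    have hone : lam.parts.filter (fun x => ¬ 2 ≤ x) =
        Multiset.replicate (lam.parts.filter (fun x => ¬ 2 ≤ x)).card 1 := by
      refine Multiset.eq_replicate_of_mem fun b hb => ?_
      rw [Multiset.mem_filter] at hb
      have := lam.parts_pos hb.1
      omega
    have hsum := congrArg Multiset.sum hsplit
    rw [Multiset.sum_add, lam.parts_sum, hone, Multiset.sum_replicate, smul_eq_mul, mul_one,
      ← h, Perm.sum_cycleType] at hsum
    unfold HasType
    rw [Perm.parts_partition, ← hsplit, hone, h]
    congr 2
    rw [Fintype.card_fin]
    omega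

theorem exists_hasType {n : ℕ} (lam : n.Partition) : ∃ σ : Perm (Fin n), HasType σ lam := by
  simp only [hasType_iff]
  rw [Perm.exists_with_cycleType_iff]
  refine ⟨?_, fun a ha => (Multiset.mem_filter.1 ha).2⟩
  rw [Fintype.card_fin]
  have h := congrArg Multiset.sum (Multiset.filter_add_not (2 ≤ ·) lam.parts)
  rw [Multiset.sum_add, lam.parts_sum] at h
  omega

theorem HasType.isConj {n : ℕ} {σ τ : Perm (Fin n)} {lam : n.Partition} (hσ : HasType σ lam)
    (hτ : HasType τ lam) : IsConj σ τ := by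
  rw [Perm.isConj_iff_cycleType_eq, hasType_iff.1 hσ, hasType_iff.1 hτ]

theorem pEquiv_refl {p : ℕ} (hp : p.Prime ∨ p = 0) {n : ℕ} (lam : n.Partition) :
    PEquiv p lam lam := by
  obtain ⟨N, hN, -⟩ := exists_pPrimePart_pow hp (Perm (Fin n))
  intro σ τ ρ π hσ hτ hρ hπ
  rw [hN] at hρ hπ
  subst hρ hπ
  exact (hσ.isConj hτ).pow N

theorem exists_pEquiv_merge {p : ℕ} (hp : p.Prime) {n : ℕ} {lam nu : n.Partition}
    (h : PEquiv p lam nu) {i : ℕ} (hi : p ≤ lam.parts.count i) :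
    ∃ lam' : n.Partition, PEquiv p lam' nu ∧ lam'.parts.card < lam.parts.card := by
  obtain ⟨N, hN, hcop⟩ := exists_pPrimePart_pow (Or.inl hp) (Perm (Fin n))
  have hle : Multiset.replicate p i ≤ lam.parts := Multiset.le_count_iff_replicate_le.1 hi
  obtain ⟨r, hr⟩ := Multiset.le_iff_exists_add.1 hle
  have hi0 : 0 < i := lam.parts_pos (Multiset.count_pos.1 (hp.pos.trans_le hi))
  have hsum := lam.parts_sum
  rw [hr, Multiset.sum_add, Multiset.sum_replicate, smul_eq_mul] at hsum
  have hpi : 2 ≤ p * i := hp.two_le.trans (Nat.le_mul_of_pos_right p hi0)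
  let lam' : n.Partition :=
    { parts := p * i ::ₘ r
      parts_pos := by
        intro j hj
        rcases Multiset.mem_cons.1 hj with rfl | hj
        · omega
        · exact lam.parts_pos (by rw [hr]; exact Multiset.mem_add.2 (Or.inr hj))
      parts_sum := by rw [Multiset.sum_cons]; exact hsum }
  refine ⟨lam', ?_, ?_⟩
  · intro τ υ ρ π hτ hυ hρ hπ
    have hτ' := hasType_iff.1 hτ
    have hfil : lam'.parts.filter (2 ≤ ·) = p * i ::ₘ r.filter (2 ≤ ·) :=
      Multiset.filter_cons_of_pos _ hpi
    rw [hfil] at hτ'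
    obtain ⟨c, d, rfl, hcd, hc, hcs⟩ := Perm.mem_cycleType_iff.1
      (by rw [hτ']; exact Multiset.mem_cons_self _ _ : p * i ∈ τ.cycleType)
    rw [hcd.cycleType_mul, hc.cycleType, hcs, Multiset.singleton_add,
      Multiset.cons_inj_right] at hτ'
    have hdis : Perm.Disjoint (c ^ p) d := by simpa using hcd.pow_disjoint_pow p 1
    have hσ : HasType (c ^ p * d) lam := by
      rw [hasType_iff, hdis.cycleType_mul, hτ', hr, Multiset.filter_add]
      congr 1
      by_cases hi2 : 2 ≤ i
      · rw [cycleType_cycle_pow hc hp.pos hi2 hcs, Multiset.filter_eq_self.2]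
        intro a ha
        rw [Multiset.eq_of_mem_replicate ha]
        exact hi2
      · have hi1 : i = 1 := by omega
        subst hi1
        rw [mul_one] at hcs
        rw [← hcs, ← hc.orderOf, pow_orderOf_eq_one, Perm.cycleType_one, eq_comm,
          Multiset.filter_eq_nil]
        intro a ha
        rw [Multiset.eq_of_mem_replicate ha]
        exact hi2
    have h1 := h _ υ _ π hσ hυ ((hN _ _).2 rfl) hπ
    refine IsConj.trans ?_ h1
    rw [hN] at hρ
    rw [hρ, hdis.commute.mul_pow, hcd.commute.mul_pow]
    refine Perm.Disjoint.isConj_mul ?_ (IsConj.refl _) (hcd.pow_disjoint_pow N N)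
      (hdis.pow_disjoint_pow N N)
    rw [pow_right_comm]
    exact (isConj_pow_of_coprime _ (hcop hp.ne_zero c)).symm
  · rw [hr]
    simp only [lam', Multiset.card_cons, Multiset.card_add, Multiset.card_replicate]
    have := hp.two_le
    omega

theorem exists_isPRegular {p : ℕ} (hp : p.Prime ∨ p = 0) {n : ℕ} (nu : n.Partition) :
    ∃ lam : n.Partition, IsPRegular p lam ∧ PEquiv p lam nu := by
  classical
  have hne : ∃ k, ∃ lam : n.Partition, PEquiv p lam nu ∧ lam.parts.card = k :=
    ⟨_, nu, pEquiv_refl hp nu, rfl⟩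
  obtain ⟨lam, h1, h2⟩ := Nat.find_spec hne
  refine ⟨lam, ?_, h1⟩
  rcases hp with hp | rfl
  · right
    intro i
    by_contra! hi
    obtain ⟨lam', h3, h4⟩ := exists_pEquiv_merge hp h1 (i := i) (by omega)
    rw [h2] at h4
    exact Nat.find_min hne h4 ⟨lam', h3, rfl⟩
  · exact Or.inl rfl

/-- The `p`-regular partitions of `n`. -/
abbrev RegPartition (p n : ℕ) : Type :=
  {lam : n.Partition // IsPRegular p lam}

noncomputable instance (p n : ℕ) : Fintype (RegPartition p n) :=
  Fintype.ofFinite _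

/-- The `p`-conjugacy class `C_{lam,p}`: the union of the conjugacy classes `C_mu` over all `mu`
that are `p`-equivalent to `lam`. -/
def pClass (p : ℕ) {n : ℕ} (lam : n.Partition) : Set (Perm (Fin n)) :=
  {σ | ∃ mu : n.Partition, PEquiv p mu lam ∧ HasType σ mu}

open Classical in
/-- The characteristic function of the `p`-conjugacy class of `lam`. -/
noncomputable def charFun (O : Type*) [CommRing O] (p : ℕ) {n : ℕ} (lam : n.Partition) :
    Perm (Fin n) → O :=
  fun σ => if σ ∈ pClass p lam then 1 else 0

/-- The partition of `n` obtained from a partition `mu` of `n - s` by adjoining a part `s`. -/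
def adjoinPart {n s : ℕ} (hs : 1 ≤ s) (hsn : s ≤ n) (mu : (n - s).Partition) : n.Partition where
  parts := s ::ₘ mu.parts
  parts_pos := by
    intro i hi
    rcases Multiset.mem_cons.1 hi with rfl | hi
    · exact hs
    · exact mu.parts_pos hi
  parts_sum := by rw [Multiset.sum_cons, mu.parts_sum]; omega

/-- `mu^{#s}`: the `p`-regular partition of `n` that is `p`-equivalent to the partition obtained
from `mu` by adjoining a part `s`. -/
noncomputable def hash {p : ℕ} (hp : p.Prime ∨ p = 0) {n s : ℕ} (hs : 1 ≤ s) (hsn : s ≤ n)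
    (mu : RegPartition p (n - s)) : RegPartition p n :=
  ⟨(exists_isPRegular hp (adjoinPart hs hsn mu.1)).choose,
    (exists_isPRegular hp (adjoinPart hs hsn mu.1)).choose_spec.1⟩

theorem hash_spec {p : ℕ} (hp : p.Prime ∨ p = 0) {n s : ℕ} (hs : 1 ≤ s) (hsn : s ≤ n)
    (mu : RegPartition p (n - s)) : PEquiv p (hash hp hs hsn mu).1 (adjoinPart hs hsn mu.1) :=
  (exists_isPRegular hp (adjoinPart hs hsn mu.1)).choose_spec.2

/-! ### Idempotents -/

/-- A primitive idempotent: a nonzero idempotent that is not the sum of two nonzero orthogonal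
idempotents. -/
def IsPrimitiveIdempotent {A : Type*} [Ring A] (e : A) : Prop :=
  IsIdempotentElem e ∧ e ≠ 0 ∧ ∀ a b : A, IsIdempotentElem a → IsIdempotentElem b →
    a * b = 0 → b * a = 0 → e = a + b → a = 0 ∨ b = 0

/-- A complete set of primitive orthogonal idempotents: a finite family of pairwise orthogonal
primitive idempotents with sum `1`. -/
def IsCompletePrimitiveOrthogonal {A I : Type*} [Ring A] [Fintype I] (e : I → A) : Prop :=
  CompleteOrthogonalIdempotents e ∧ ∀ i, IsPrimitiveIdempotent (e i)

open Classical in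
noncomputable instance {p n s : ℕ} (hp : p.Prime ∨ p = 0) (hs : 1 ≤ s) (hsn : s ≤ n) :
    Fintype (Set.range (hash hp hs hsn)) :=
  Fintype.ofFinite _

end DescentAlgebra

/-! The map `Δ_s` is a unital homomorphism of algebras, and through `θ` it becomes evaluation at
permutations with an adjoined `s`-cycle: `θ(Δ_s x)(σ) = θ(x)(σc)`, where `c` is a cycle on `s` new
points (`Delta_mul`, `Delta_one`, `theta_Delta`). Hence the `Δ_s(e_λ)` are pairwise orthogonal
idempotents with sum `1`, and `θ(Δ_s(e_λ))` is the function `σ ↦ char_λ(σc)`. Adjoining the same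
cycle to two permutations preserves and reflects conjugacy of their `p'`-parts (`pConj_addCycle`),
so this function is `char_μ` if `λ = μ^{#s}`, and `0` if `λ` lies outside `Υ`. It remains to see
that an idempotent with image `0` under `θ` is `0`, and that one with image `char_μ` is primitive.

Multiplicativity of `Δ_s` comes from the product rule `desElem_mul_desElem`: `Ξ^a Ξ^b` is the sum of
`Ξ^M` over the matrices `M` of natural numbers with row sums `a` and column sums `b`, read row by
row without the zeros. Subtracting `s` from the entry `(i, j)` of `M` subtracts `s` from `a i` and
from `b j`, so both sides of the required identity have the same terms.

For `θ`, filter the descent algebra by the number of parts. If all parts of `a` are positive, then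
`M` has at least as many nonzero entries as `a` has parts, with equality only if every row has
exactly one. Such matrices distribute the parts of `a` among the parts of `b`. If `a` lists the
cycle lengths of `σ`, their number is the number of cosets of the Young subgroup of `b` fixed by
`σ`. So `Ξ^a x` is `θ(x)(σ) Ξ^a` modulo longer compositions. Therefore `θ` is multiplicative, and
right multiplication by an element of its kernel raises the filtration, so that the kernel contains
no nonzero idempotent (`eq_zero_of_theta_eq_zero`).

Finally, `θ(x)` is constant on `p`-classes, because a permutation and its `p`-th power have
congruent numbers of fixed points modulo `p`. If `e = a + b` is an orthogonal decomposition and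
`θ(e) = char_μ`, then one of `θ(a)`, `θ(b)` vanishes on the class of `μ`; it vanishes off the class
as well, and the corresponding summand is `0`. -/

namespace DescentAlgebra

open Equiv MulOpposite

/-! ### Words and their contents -/

/-- The content of a word `m`: the number of occurrences of every letter. -/
def content {ι α : Type*} [Fintype ι] [DecidableEq α] (m : ι → α) : α → ℕ :=
  fun j => (Finset.univ.filter fun x => m x = j).card

theorem sum_content {ι α : Type*} [Fintype ι] [Fintype α] [DecidableEq α] (m : ι → α) :
    ∑ j, content m j = Fintype.card ι :=
  (Finset.card_eq_sum_card_fiberwise (s := Finset.univ) (t := Finset.univ)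
    fun x _ => Finset.mem_coe.2 (Finset.mem_univ (m x))).symm

theorem content_comp_perm {ι α : Type*} [Fintype ι] [DecidableEq α] (m : ι → α) (g : Perm ι) :
    content (m ∘ g) = content m := by
  funext j
  exact Finset.card_bij (fun x _ => g x) (by simp) (by simp) fun y hy =>
    ⟨g⁻¹ y, by simpa using hy, by simp⟩

theorem content_comp {ι α β : Type*} [Fintype ι] [Fintype α] [DecidableEq α] [DecidableEq β]
    (m : ι → α) (f : α → β) (j : β) :
    content (f ∘ m) j = ∑ i with f i = j, content m i := by
  unfold content
  rw [Finset.card_eq_sum_card_fiberwise (f := m) (t := Finset.univ.filter fun i => f i = j)]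
  · refine Finset.sum_congr rfl fun i hi => ?_
    congr 1
    ext x
    simp only [Finset.mem_filter, Finset.mem_univ, true_and, Function.comp] at hi ⊢
    exact ⟨fun h => h.2, fun h => ⟨by rw [h, hi], h⟩⟩
  · intro x hx
    simpa using hx

theorem exists_perm_of_content_eq {ι α : Type*} [Fintype ι] [DecidableEq α] {m m' : ι → α}
    (h : content m = content m') : ∃ g : Perm ι, m = m' ∘ g := by
  have hc : ∀ j, Nonempty ({x // m x = j} ≃ {x // m' x = j}) := fun j => by
    refine ⟨Fintype.equivOfCardEq ?_⟩
    rw [Fintype.card_subtype, Fintype.card_subtype]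
    exact congrFun h j
  refine ⟨Equiv.ofFiberEquiv fun j => (hc j).some, ?_⟩
  funext x
  exact (Equiv.ofFiberEquiv_map (fun j => (hc j).some) x).symm

theorem monotone_word_unique {n : ℕ} {α : Type*} [LinearOrder α] {m m' : Fin n → α}
    (hm : Monotone m) (hm' : Monotone m') (h : content m = content m') : m = m' := by
  obtain ⟨g, rfl⟩ := exists_perm_of_content_eq h
  exact Tuple.unique_monotone (f := m') (σ := g) (τ := 1) hm hm'

theorem exists_monotone_word {n : ℕ} {α : Type*} [Fintype α] [LinearOrder α] {a : α → ℕ}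
    (ha : ∑ j, a j = n) : ∃ m : Fin n → α, Monotone m ∧ content m = a := by
  have hcard : Fintype.card (Fin n) = Fintype.card (Σ j, Fin (a j)) := by simp [ha]
  let φ := Fintype.equivOfCardEq hcard
  let m : Fin n → α := fun x => (φ x).1
  refine ⟨m ∘ Tuple.sort m, Tuple.monotone_sort m, ?_⟩
  rw [content_comp_perm]
  funext j
  unfold content
  rw [← Fintype.card_subtype, Fintype.card_congr (φ.subtypeEquiv (q := fun y => y.1 = j)
    fun x => Iff.rfl), Fintype.card_congr (Equiv.sigmaSubtype j)]
  simp

theorem content_index {n : ℕ} (q : Composition n) : content q.index = q.blocksFun := by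
  funext i
  unfold content
  have : (Finset.univ.filter fun x => q.index x = i) =
      Finset.univ.map (q.embedding i).toEmbedding := by
    ext x
    have := q.mem_range_embedding_iff' (j := x) (i := i)
    simp only [Finset.mem_filter, Finset.mem_univ, true_and, Finset.mem_map]
    rw [eq_comm, ← this]
    rfl
  rw [this, Finset.card_map, Finset.card_univ, Fintype.card_fin]

theorem index_surjective {n : ℕ} (q : Composition n) : Function.Surjective q.index := fun i =>
  ⟨q.embedding i ⟨0, q.one_le_blocksFun i⟩, q.index_embedding i _⟩

/-- A monotone word factors through the blocks of a composition. -/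
theorem exists_factor {n : ℕ} {α : Type*} [LinearOrder α] {m : Fin n → α} (hm : Monotone m) :
    ∃ (q : Composition n) (f : Fin q.length → α), StrictMono f ∧ m = f ∘ q.index := by
  obtain ⟨q, hq⟩ := exists_index_eq hm
  obtain ⟨t, ht⟩ := (index_surjective q).hasRightInverse
  refine ⟨q, m ∘ t, fun i j hij => ?_, ?_⟩
  · have hlt : t i < t j := (index_monotone q).reflect_lt (by rwa [ht, ht])
    refine lt_of_le_of_ne (hm hlt.le) fun e => hij.ne ?_
    have := (hq _ _).2 e
    rwa [ht, ht] at this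
  · funext x
    exact (hq _ _).1 (ht (q.index x)).symm

/-! ### The elements of the descent algebra attached to weak compositions -/

/-- The nonzero values of `a`, in increasing order of the arguments. -/
def nonzeroValues {α : Type*} [Fintype α] [LinearOrder α] (a : α → ℕ) : List ℕ :=
  ((Finset.univ.filter fun j => 0 < a j).sort (· ≤ ·)).map a

theorem sum_nonzeroValues {α : Type*} [Fintype α] [LinearOrder α] (a : α → ℕ) :
    (nonzeroValues a).sum = ∑ j, a j := by
  have h : (nonzeroValues a).sum = ∑ j with 0 < a j, a j := by
    rw [Finset.sum, ← Finset.sort_eq _ (· ≤ ·), Multiset.map_coe, Multiset.sum_coe]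
    rfl
  rw [h, Finset.sum_filter_of_ne]
  exact fun x _ hx => Nat.pos_of_ne_zero hx

theorem length_nonzeroValues {α : Type*} [Fintype α] [LinearOrder α] (a : α → ℕ) :
    (nonzeroValues a).length = (Finset.univ.filter fun j => 0 < a j).card := by
  simp [nonzeroValues]

/-- The composition of `n` obtained by deleting the zeros of a weak composition. -/
def compOf {n : ℕ} {α : Type*} [Fintype α] [LinearOrder α] (a : α → ℕ) (h : ∑ j, a j = n) :
    Composition n where
  blocks := nonzeroValues a
  blocks_pos := by
    intro i hi
    simp only [nonzeroValues, List.mem_map, Finset.mem_sort, Finset.mem_filter] at hi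
    obtain ⟨j, hj, rfl⟩ := hi
    exact hj.2
  blocks_sum := (sum_nonzeroValues a).trans h

/-- Order-preserving relabelling and padding by zeros do not affect the list. This is what allows
weak compositions indexed by different ordered sets (blocks, pairs in lexicographic order) to be
compared. -/
theorem nonzeroValues_eq_of_strictMono {α β : Type*} [Fintype α] [LinearOrder α] [Fintype β]
    [LinearOrder β] {a : α → ℕ} {b : β → ℕ} {f : α → β} (hf : StrictMono f)
    (hab : ∀ i, b (f i) = a i) (h0 : ∀ j, j ∉ Set.range f → b j = 0) :
    nonzeroValues b = nonzeroValues a := by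
  have hset : (Finset.univ.filter fun j => 0 < b j) =
      (Finset.univ.filter fun i => 0 < a i).map ⟨f, hf.injective⟩ := by
    ext j
    simp only [Finset.mem_filter, Finset.mem_univ, true_and, Finset.mem_map,
      Function.Embedding.coeFn_mk]
    constructor
    · intro hj
      by_cases hr : j ∈ Set.range f
      · obtain ⟨i, rfl⟩ := hr
        exact ⟨i, by rwa [← hab], rfl⟩
      · rw [h0 j hr] at hj
        exact absurd hj (lt_irrefl 0)
    · rintro ⟨i, hi, rfl⟩
      rwa [hab]
  unfold nonzeroValues
  rw [hset, ← StrictMonoOn.map_finsetSort ⟨f, hf.injective⟩ _ (hf.strictMonoOn _),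
    List.map_map]
  exact List.map_congr_left fun i _ => hab i

theorem nonzeroValues_fin {k : ℕ} (a : Fin k → ℕ) :
    nonzeroValues a = (List.ofFn a).filter (0 < ·) := by
  rw [List.ofFn_eq_map, List.filter_map, ← Fin.sort_univ]
  unfold nonzeroValues
  congr 1
  refine List.Pairwise.eq_of_mem_iff (r := (· < ·)) (Finset.sortedLT_sort _).pairwise
    ((Finset.sortedLT_sort _).pairwise.filter _) fun i => ?_
  simp

theorem nonzeroValues_blocksFun {n : ℕ} (q : Composition n) :
    nonzeroValues q.blocksFun = q.blocks := by
  rw [nonzeroValues_fin, List.filter_eq_self.2]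
  · exact q.ofFn_blocksFun
  · intro i hi
    rw [q.ofFn_blocksFun] at hi
    simpa using q.blocks_pos hi

/-- The basis element of the descent algebra that belongs to a weak composition of `n`
(and `0` if the sum is not `n`). -/
noncomputable def desElem (O : Type*) [CommRing O] (n : ℕ) {α : Type*} [Fintype α] [LinearOrder α]
    (a : α → ℕ) : Des O n :=
  if h : ∑ j, a j = n then desBasis O n (compOf a h) else 0

theorem desElem_of_sum {O : Type*} [CommRing O] {n : ℕ} {α : Type*} [Fintype α] [LinearOrder α]
    {a : α → ℕ} (h : ∑ j, a j = n) : desElem O n a = desBasis O n (compOf a h) :=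
  dif_pos h

theorem desElem_eq_desBasis {O : Type*} [CommRing O] {n : ℕ} {α : Type*} [Fintype α]
    [LinearOrder α] {a : α → ℕ} {q : Composition n} (h : nonzeroValues a = q.blocks) :
    desElem O n a = desBasis O n q := by
  have hs : ∑ j, a j = n := by rw [← sum_nonzeroValues, h, q.blocks_sum]
  rw [desElem_of_sum hs]
  congr 1
  exact Composition.ext h

theorem desElem_blocksFun (O : Type*) [CommRing O] {n : ℕ} (q : Composition n) :
    desElem O n q.blocksFun = desBasis O n q :=
  desElem_eq_desBasis (nonzeroValues_blocksFun q)

theorem desElem_congr {O : Type*} [CommRing O] {n : ℕ} {α β : Type*} [Fintype α] [LinearOrder α]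
    [Fintype β] [LinearOrder β] {a : α → ℕ} {b : β → ℕ} (h : nonzeroValues a = nonzeroValues b) :
    desElem O n a = desElem O n b := by
  unfold desElem
  have hs : ∑ j, a j = ∑ j, b j := by rw [← sum_nonzeroValues, h, sum_nonzeroValues]
  by_cases hb : ∑ j, b j = n
  · rw [dif_pos hb, dif_pos (hs.trans hb)]
    congr 1
    exact Composition.ext h
  · rw [dif_neg hb, dif_neg (hs ▸ hb)]

open Classical in
/-- The sum of the permutations that are increasing on the fibres of a word. -/
noncomputable def wordSum (O : Type*) [CommRing O] {n : ℕ} {α : Type*} (m : Fin n → α) :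
    SymAlgebra O n :=
  ∑ g : Perm (Fin n) with FibInc m g, MonoidAlgebra.of O (Perm (Fin n))ᵐᵒᵖ (op g)

theorem fibInc_comp {n : ℕ} {α β : Type*} {f : α → β} (hf : Function.Injective f)
    (m : Fin n → α) (g : Perm (Fin n)) : FibInc (f ∘ m) g ↔ FibInc m g := by
  simp only [FibInc, Function.comp, hf.eq_iff]

theorem wordSum_comp (O : Type*) [CommRing O] {n : ℕ} {α β : Type*} {f : α → β}
    (hf : Function.Injective f) (m : Fin n → α) : wordSum O (f ∘ m) = wordSum O m := by
  refine Finset.sum_congr ?_ fun _ _ => rfl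
  ext g
  simp only [Finset.mem_filter, fibInc_comp hf]

theorem wordSum_index (O : Type*) [CommRing O] {n : ℕ} (q : Composition n) :
    wordSum O q.index = Xi O q := (Xi_eq O q).symm

theorem content_comp_apply {ι α β : Type*} [Fintype ι] [DecidableEq α] [DecidableEq β]
    {f : α → β} (hf : Function.Injective f) (m : ι → α) (i : α) :
    content (f ∘ m) (f i) = content m i := by
  simp only [content, Function.comp, hf.eq_iff]

theorem content_eq_zero {ι α : Type*} [Fintype ι] [DecidableEq α] {m : ι → α} {j : α}
    (h : j ∉ Set.range m) : content m j = 0 := by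
  rw [content, Finset.card_eq_zero, Finset.filter_eq_empty_iff]
  exact fun x _ e => h ⟨x, e⟩

/-- The condition `FibInc` sees only the fibres of the word, so unused letters play no role, and the
fibres of a monotone word are the blocks of a composition. -/
theorem coe_desElem_content (O : Type*) [CommRing O] {n : ℕ} {α : Type*} [Fintype α]
    [LinearOrder α] {m : Fin n → α} (hm : Monotone m) :
    (desElem O n (content m) : SymAlgebra O n) = wordSum O m := by
  obtain ⟨q, f, hf, rfl⟩ := exists_factor hm
  rw [wordSum_comp O hf.injective, wordSum_index, ← desBasis_apply, desElem_eq_desBasis]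
  rw [nonzeroValues_eq_of_strictMono hf (content_comp_apply hf.injective q.index)
    fun j hj => content_eq_zero fun h => hj (Set.range_comp_subset_range _ _ h), content_index,
    nonzeroValues_blocksFun]

/-! ### The product formula -/

/-- The pair of letters attached to a position by `g`. -/
def pairLetters {n : ℕ} {α β : Type*} (m : Fin n → α) (m' : Fin n → β) (g : Perm (Fin n)) :
    Fin n → α ×ₗ β :=
  fun i => toLex (m i, m' (g i))

-- Transports `Xi_mul_Xi` from block indices to arbitrary ordered letters: both words factor through
-- compositions by strictly increasing maps, and these induce an injection on pairs of letters.
open Classical in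
theorem wordSum_mul_wordSum (O : Type*) [CommRing O] {n : ℕ} {α β : Type*} [LinearOrder α]
    [LinearOrder β] {m : Fin n → α} {m' : Fin n → β} (hm : Monotone m) (hm' : Monotone m') :
    wordSum O m * wordSum O m' =
      ∑ w ∈ (Finset.univ.filter (FibInc m)).image (pairLetters m m'), wordSum O w := by
  obtain ⟨r, f, hf, rfl⟩ := exists_factor hm
  obtain ⟨q, f', hf', rfl⟩ := exists_factor hm'
  have hF : Function.Injective fun x : Fin r.length ×ₗ Fin q.length =>
      (toLex (f (ofLex x).1, f' (ofLex x).2) : α ×ₗ β) := by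
    intro x y hxy
    have h := Prod.mk.inj (toLex_inj.1 hxy)
    exact ofLex_inj.1 (Prod.ext (hf.injective h.1) (hf'.injective h.2))
  rw [wordSum_comp O hf.injective, wordSum_comp O hf'.injective, wordSum_index, wordSum_index,
    Xi_mul_Xi]
  have himg : (Finset.univ.filter (FibInc (f ∘ r.index))).image
      (pairLetters (f ∘ r.index) (f' ∘ q.index)) =
      ((Finset.univ.filter (FibInc r.index)).image (pairWord r q)).image
        (fun w => (fun x : Fin r.length ×ₗ Fin q.length =>
          (toLex (f (ofLex x).1, f' (ofLex x).2) : α ×ₗ β)) ∘ w) := by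
    rw [Finset.image_image]
    simp only [fibInc_comp hf.injective]
    rfl
  rw [himg, Finset.sum_image fun w _ w' _ h => hF.comp_left h]
  exact Finset.sum_congr rfl fun w _ => (wordSum_comp O hF w).symm

/-- The matrices of natural numbers, indexed lexicographically, with given row sums and column
sums. -/
def marginMatrices {α β : Type*} [Fintype α] [Fintype β] [LinearOrder α] [LinearOrder β]
    (a : α → ℕ) (b : β → ℕ) : Finset (α ×ₗ β → ℕ) :=
  (Fintype.piFinset fun x => Finset.range (a (ofLex x).1 + 1)).filter fun M =>
    (∀ i, ∑ j, M (toLex (i, j)) = a i) ∧ ∀ j, ∑ i, M (toLex (i, j)) = b j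

theorem mem_marginMatrices {α β : Type*} [Fintype α] [Fintype β] [LinearOrder α] [LinearOrder β]
    {a : α → ℕ} {b : β → ℕ} {M : α ×ₗ β → ℕ} :
    M ∈ marginMatrices a b ↔
      (∀ i, ∑ j, M (toLex (i, j)) = a i) ∧ ∀ j, ∑ i, M (toLex (i, j)) = b j := by
  simp only [marginMatrices, Finset.mem_filter, Fintype.mem_piFinset, Finset.mem_range,
    and_iff_right_iff_imp]
  rintro ⟨h, -⟩ x
  rw [Nat.lt_succ_iff, ← h]
  exact Finset.single_le_sum (f := fun j => M (toLex ((ofLex x).1, j))) (fun _ _ => Nat.zero_le _)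
    (Finset.mem_univ (ofLex x).2)

theorem sum_lex {R α β : Type*} [AddCommMonoid R] [Fintype α] [Fintype β] (M : α ×ₗ β → R) :
    ∑ x, M x = ∑ i, ∑ j, M (toLex (i, j)) := by
  rw [← Fintype.sum_prod_type' (f := fun i j => M (toLex (i, j)))]
  exact (Equiv.sum_comp toLex M).symm

theorem content_fst {ι α β : Type*} [Fintype ι] [Fintype α] [Fintype β] [DecidableEq α]
    [DecidableEq β] (w : ι → α ×ₗ β) (i : α) :
    ∑ j, content w (toLex (i, j)) = content (fun x => (ofLex (w x)).1) i := by
  have := content_comp w (fun x => (ofLex x).1) i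
  rw [Function.comp_def] at this
  rw [this, Finset.sum_filter, sum_lex, Finset.sum_comm]
  exact Finset.sum_congr rfl fun y _ =>
    (Fintype.sum_ite_eq' i fun x => content w (toLex (x, y))).symm

theorem content_snd {ι α β : Type*} [Fintype ι] [Fintype α] [Fintype β] [DecidableEq α]
    [DecidableEq β] (w : ι → α ×ₗ β) (j : β) :
    ∑ i, content w (toLex (i, j)) = content (fun x => (ofLex (w x)).2) j := by
  have := content_comp w (fun x => (ofLex x).2) j
  rw [Function.comp_def] at this
  rw [this, Finset.sum_filter, sum_lex]
  exact Finset.sum_congr rfl fun x _ =>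
    (Fintype.sum_ite_eq' j fun y => content w (toLex (x, y))).symm

theorem pairLetters_monotone {n : ℕ} {α β : Type*} [LinearOrder α] [LinearOrder β]
    {m : Fin n → α} {m' : Fin n → β} (hm : Monotone m) (hm' : Monotone m') {g : Perm (Fin n)}
    (hg : FibInc m g) : Monotone (pairLetters m m' g) := by
  intro i j hij
  rcases hij.eq_or_lt with rfl | hij
  · exact le_rfl
  simp only [pairLetters, Prod.Lex.le_iff, ofLex_toLex]
  rcases (hm hij.le).eq_or_lt with h | h
  · exact Or.inr ⟨h, hm' (hg i j hij h).le⟩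
  · exact Or.inl h

-- The words in the product are monotone for the lexicographic order, hence determined by their
-- contents. These contents are matrices whose margins are the contents of the two factors, and
-- every such matrix occurs.
open Classical in
theorem desElem_mul_desElem (O : Type*) [CommRing O] {n : ℕ} {α β : Type*} [Fintype α]
    [Fintype β] [LinearOrder α] [LinearOrder β] {a : α → ℕ} {b : β → ℕ} (ha : ∑ i, a i = n)
    (hb : ∑ j, b j = n) :
    desElem O n a * desElem O n b = ∑ M ∈ marginMatrices a b, desElem O n M := by
  obtain ⟨m, hm, rfl⟩ := exists_monotone_word ha
  obtain ⟨m', hm', rfl⟩ := exists_monotone_word hb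
  apply Subtype.ext
  rw [MulMemClass.coe_mul, coe_desElem_content O hm, coe_desElem_content O hm',
    wordSum_mul_wordSum O hm hm', AddSubmonoidClass.coe_finsetSum]
  have hmono : ∀ w ∈ (Finset.univ.filter (FibInc m)).image (pairLetters m m'), Monotone w := by
    intro w hw
    simp only [Finset.mem_image, Finset.mem_filter, Finset.mem_univ, true_and] at hw
    obtain ⟨g, hg, rfl⟩ := hw
    exact pairLetters_monotone hm hm' hg
  refine Finset.sum_bij (fun w _ => content w) ?_ ?_ ?_ ?_
  · intro w hw
    simp only [Finset.mem_image, Finset.mem_filter, Finset.mem_univ, true_and] at hw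
    obtain ⟨g, hg, rfl⟩ := hw
    rw [mem_marginMatrices]
    refine ⟨fun i => ?_, fun j => ?_⟩
    · rw [content_fst]; rfl
    · rw [content_snd]; exact congrFun (content_comp_perm m' g) j
  · exact fun w hw w' hw' h => monotone_word_unique (hmono w hw) (hmono w' hw') h
  · intro M hM
    rw [mem_marginMatrices] at hM
    have hsum : ∑ x, M x = n := by rw [sum_lex]; simp only [hM.1, ha]
    obtain ⟨w, hw, rfl⟩ := exists_monotone_word hsum
    refine ⟨w, ?_, rfl⟩
    have h1 : (fun x => (ofLex (w x)).1) = m := by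
      refine monotone_word_unique (fun i j hij => ?_) hm ?_
      · rcases Prod.Lex.le_iff.1 (hw hij) with h | h
        · exact h.le
        · exact h.1.le
      · funext i
        rw [← content_fst, hM.1]
    have h2 : content (fun x => (ofLex (w x)).2) = content m' := by
      funext j
      rw [← content_snd, hM.2]
    -- The required permutation is the inverse of the stable sort of the second letters `d`. Sorting
    -- `d` gives `m'`, and stability makes the inverse increasing wherever `m` is constant, since
    -- `d` is weakly increasing there.
    set d : Fin n → β := fun x => (ofLex (w x)).2 with hd
    have h3 : d ∘ Tuple.sort d = m' :=
      monotone_word_unique (Tuple.monotone_sort d) hm' (by rw [content_comp_perm, h2])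
    have h4 : ∀ x, m' ((Tuple.sort d)⁻¹ x) = d x := fun x => by
      rw [← h3]; simp
    simp only [Finset.mem_image, Finset.mem_filter, Finset.mem_univ, true_and]
    refine ⟨(Tuple.sort d)⁻¹, ?_, ?_⟩
    · intro i j hij e
      rw [← h1] at e
      have hle : d i ≤ d j := by
        rcases Prod.Lex.le_iff.1 (hw hij.le) with h | h
        · exact absurd e h.ne
        · exact h.2
      by_contra hc
      rcases (not_lt.1 hc).eq_or_lt with h | h
      · exact hij.ne ((Tuple.sort d)⁻¹.injective h).symm
      · have h5 := hm' h.le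
        rw [h4, h4] at h5
        have := ((Tuple.eq_sort_iff (f := d) (σ := Tuple.sort d)).1 rfl).2 _ _ h
          (by simpa using le_antisymm h5 hle)
        simp at this
        exact lt_asymm this hij
    · funext x
      simp only [pairLetters, h4]
      rw [← h1]
      rfl
  · intro w hw
    exact (coe_desElem_content O (hmono w hw)).symm

/-! ### `Δ_s` is a homomorphism of algebras -/

theorem exists_strictMono_blocksFun {n : ℕ} {α : Type*} [Fintype α] [LinearOrder α] {a : α → ℕ}
    (ha : ∑ j, a j = n) : ∃ (q : Composition n) (f : Fin q.length → α), StrictMono f ∧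
      (∀ i, a (f i) = q.blocksFun i) ∧ ∀ j, j ∉ Set.range f → a j = 0 := by
  obtain ⟨m, hm, rfl⟩ := exists_monotone_word ha
  obtain ⟨q, f, hf, rfl⟩ := exists_factor hm
  refine ⟨q, f, hf, fun i => ?_, fun j hj => ?_⟩
  · rw [content_comp_apply hf.injective, content_index]
  · exact content_eq_zero fun h => hj (Set.range_comp_subset_range _ _ h)

theorem nonzeroValues_sub_single {n : ℕ} (q : Composition n) (s : ℕ) (i : Fin q.length)
    (h : s ≤ q.blocksFun i) :
    nonzeroValues (q.blocksFun - Pi.single i s) = (subPart q s i h).blocks := by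
  rw [nonzeroValues_fin]
  change _ = (q.blocks.set i (q.blocksFun i - s)).filter (0 < ·)
  congr 1
  refine List.ext_getElem (by simp) fun k hk _ => ?_
  rw [List.getElem_ofFn, List.getElem_set]
  split_ifs with hik
  · have : (⟨k, by simpa using hk⟩ : Fin q.length) = i := Fin.ext hik.symm
    rw [this]
    simp
  · have : (⟨k, by simpa using hk⟩ : Fin q.length) ≠ i := fun e => hik (congrArg Fin.val e).symm
    simp only [Pi.sub_apply, Pi.single_eq_of_ne this]
    rfl

theorem Delta_desBasis (O : Type*) [CommRing O] {n s : ℕ} (q : Composition n) :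
    Delta O n s (desBasis O n q) =
      ∑ i with s ≤ q.blocksFun i, desElem O (n - s) (q.blocksFun - Pi.single i s) := by
  rw [Delta, Module.Basis.constr_basis, ← Finset.sum_subtype_eq_sum_filter, Finset.subtype_univ]
  exact Finset.sum_congr rfl fun i _ =>
    (desElem_eq_desBasis (nonzeroValues_sub_single q s i.1 i.2)).symm

theorem Delta_desElem (O : Type*) [CommRing O] {n s : ℕ} (hs : 1 ≤ s) {α : Type*} [Fintype α]
    [LinearOrder α] {a : α → ℕ} (ha : ∑ j, a j = n) :
    Delta O n s (desElem O n a) =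
      ∑ j with s ≤ a j, desElem O (n - s) (a - Pi.single j s) := by
  obtain ⟨q, f, hf, hfa, h0⟩ := exists_strictMono_blocksFun ha
  have hset : (Finset.univ.filter fun j => s ≤ a j) =
      (Finset.univ.filter fun i => s ≤ q.blocksFun i).map ⟨f, hf.injective⟩ := by
    ext j
    simp only [Finset.mem_filter, Finset.mem_univ, true_and, Finset.mem_map,
      Function.Embedding.coeFn_mk]
    constructor
    · intro hj
      by_cases hr : j ∈ Set.range f
      · obtain ⟨i, rfl⟩ := hr
        exact ⟨i, by rwa [← hfa], rfl⟩
      · rw [h0 j hr] at hj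
        -- Here `1 ≤ s` is essential: for `s = 0` the zero entries outside the range of `f` would
        -- contribute extra terms.
        omega
    · rintro ⟨i, hi, rfl⟩
      rwa [hfa]
  rw [desElem_eq_desBasis ((nonzeroValues_eq_of_strictMono hf hfa h0).trans
    (nonzeroValues_blocksFun q)), Delta_desBasis, hset, Finset.sum_map]
  refine Finset.sum_congr rfl fun i _ => desElem_congr (Eq.symm ?_)
  refine nonzeroValues_eq_of_strictMono hf (fun k => ?_) fun j hj => ?_
  · simp only [Function.Embedding.coeFn_mk, Pi.sub_apply, hfa, Pi.single_apply, hf.injective.eq_iff]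
  · simp [h0 j hj]

theorem sub_single_add_single {α : Type*} [DecidableEq α] {a : α → ℕ} {i : α} {s : ℕ}
    (h : s ≤ a i) : a - Pi.single i s + Pi.single i s = a := by
  rw [tsub_add_cancel_of_le]
  intro j
  by_cases hj : j = i
  · subst hj; simpa using h
  · simp [hj]

theorem sum_sub_single {α : Type*} [Fintype α] [DecidableEq α] {a : α → ℕ} {i : α} {s : ℕ}
    (h : s ≤ a i) : ∑ j, (a - Pi.single i s : α → ℕ) j = (∑ j, a j) - s := by
  conv_rhs => rw [← sub_single_add_single h]
  simp [Finset.sum_add_distrib]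

/-! ### Subtracting `s` from one entry of a matrix with given margins. -/

section Matrices

variable {α β : Type*} [Fintype α] [Fintype β] [LinearOrder α] [LinearOrder β]

theorem add_single_mem_marginMatrices {a : α → ℕ} {b : β → ℕ} {M : α ×ₗ β → ℕ} (i : α) (j : β)
    (s : ℕ) : M + Pi.single (toLex (i, j)) s ∈
      marginMatrices (a + Pi.single i s) (b + Pi.single j s) ↔ M ∈ marginMatrices a b := by
  have h1 : ∀ i', ∑ j', (Pi.single (toLex (i, j)) s : α ×ₗ β → ℕ) (toLex (i', j')) =
      (Pi.single i s : α → ℕ) i' := by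
    intro i'
    by_cases h : i' = i
    · subst h
      simp [Pi.single_apply]
    · simp [h]
  have h2 : ∀ j', ∑ i', (Pi.single (toLex (i, j)) s : α ×ₗ β → ℕ) (toLex (i', j')) =
      (Pi.single j s : β → ℕ) j' := by
    intro j'
    by_cases h : j' = j
    · subst h
      simp [Pi.single_apply]
    · simp [h]
  simp only [mem_marginMatrices, Pi.add_apply, Finset.sum_add_distrib, h1, h2, add_left_inj]

theorem entry_le_of_mem {a : α → ℕ} {b : β → ℕ} {M : α ×ₗ β → ℕ} (hM : M ∈ marginMatrices a b)
    (i : α) (j : β) : M (toLex (i, j)) ≤ a i ∧ M (toLex (i, j)) ≤ b j := by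
  rw [mem_marginMatrices] at hM
  rw [← hM.1, ← hM.2]
  exact ⟨Finset.single_le_sum (f := fun j => M (toLex (i, j))) (fun _ _ => Nat.zero_le _)
    (Finset.mem_univ j), Finset.single_le_sum (f := fun i => M (toLex (i, j)))
    (fun _ _ => Nat.zero_le _) (Finset.mem_univ i)⟩

/-- Subtracting `s` at the position `(i, j)` is a bijection between the two sets of matrices, with
addition of `s` as its inverse. It changes only the sums of row `i` and column `j`. -/
theorem sum_marginMatrices_sub {R : Type*} [AddCommMonoid R] (G : (α ×ₗ β → ℕ) → R) {a : α → ℕ}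
    {b : β → ℕ} {i : α} {j : β} {s : ℕ} (hi : s ≤ a i) (hj : s ≤ b j) :
    ∑ M ∈ marginMatrices a b with s ≤ M (toLex (i, j)), G (M - Pi.single (toLex (i, j)) s) =
      ∑ M ∈ marginMatrices (a - Pi.single i s) (b - Pi.single j s), G M := by
  refine Finset.sum_bij' (fun M _ => M - Pi.single (toLex (i, j)) s)
    (fun M _ => M + Pi.single (toLex (i, j)) s) ?_ ?_ ?_ ?_ ?_
  · intro M hM
    rw [Finset.mem_filter] at hM
    rw [← add_single_mem_marginMatrices i j s, sub_single_add_single hM.2,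
      sub_single_add_single hi, sub_single_add_single hj]
    exact hM.1
  · intro M hM
    rw [← add_single_mem_marginMatrices i j s, sub_single_add_single hi,
      sub_single_add_single hj] at hM
    rw [Finset.mem_filter]
    exact ⟨hM, by simp⟩
  · intro M hM
    rw [Finset.mem_filter] at hM
    exact sub_single_add_single hM.2
  · intro M _
    exact add_tsub_cancel_right _ _
  · intro M _
    rfl

theorem Delta_desElem_mul (O : Type*) [CommRing O] {n s : ℕ} (hs : 1 ≤ s) {a : α → ℕ} {b : β → ℕ}
    (ha : ∑ i, a i = n) (hb : ∑ j, b j = n) :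
    Delta O n s (desElem O n a * desElem O n b) =
      Delta O n s (desElem O n a) * Delta O n s (desElem O n b) := by
  have hM : ∀ M ∈ marginMatrices a b, ∑ x, M x = n := by
    intro M hM
    rw [mem_marginMatrices] at hM
    rw [sum_lex]
    simp only [hM.1, ha]
  rw [desElem_mul_desElem O ha hb, map_sum, Delta_desElem O hs ha, Delta_desElem O hs hb,
    Finset.sum_mul_sum, Finset.sum_congr rfl fun M h => Delta_desElem O hs (hM M h)]
  have hlex : ∀ M : α ×ₗ β → ℕ,
      ∑ x with s ≤ M x, desElem O (n - s) (M - Pi.single x s) =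
        ∑ i, ∑ j, if s ≤ M (toLex (i, j)) then
          desElem O (n - s) (M - Pi.single (toLex (i, j)) s) else 0 := fun M => by
    rw [Finset.sum_filter, sum_lex]
  simp only [hlex]
  simp only [Finset.sum_filter]
  -- The sum over matrices is exchanged with the sums over the position `(i, j)`. If `a i < s` or `b
  -- j < s`, no matrix has an entry of size at least `s` there, so only the positions occurring on
  -- the right contribute.
  rw [Finset.sum_comm]
  refine Finset.sum_congr rfl fun i _ => ?_
  rw [Finset.sum_comm]
  split_ifs with hi
  · refine Finset.sum_congr rfl fun j _ => ?_
    rw [← Finset.sum_filter]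
    split_ifs with hj
    · rw [desElem_mul_desElem O (by rw [sum_sub_single hi, ha]) (by rw [sum_sub_single hj, hb]),
        sum_marginMatrices_sub _ hi hj]
    · rw [Finset.filter_eq_empty_iff.2, Finset.sum_empty]
      exact fun M hM h => hj (h.trans (entry_le_of_mem hM i j).2)
  · refine Finset.sum_eq_zero fun j _ => ?_
    rw [← Finset.sum_filter, Finset.filter_eq_empty_iff.2, Finset.sum_empty]
    exact fun M hM h => hi (h.trans (entry_le_of_mem hM i j).1)

end Matrices

theorem Delta_mul {O : Type*} [CommRing O] {n s : ℕ} (hs : 1 ≤ s) (x y : Des O n) :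
    Delta O n s (x * y) = Delta O n s x * Delta O n s y := by
  have h : (LinearMap.mul O (Des O n)).compr₂ (Delta O n s) =
      (LinearMap.mul O (Des O (n - s))).compl₁₂ (Delta O n s) (Delta O n s) := by
    refine (desBasis O n).ext fun q => (desBasis O n).ext fun r => ?_
    simp only [LinearMap.compr₂_apply, LinearMap.mul_apply', LinearMap.compl₁₂_apply]
    rw [← desElem_blocksFun, ← desElem_blocksFun]
    exact Delta_desElem_mul O hs q.sum_blocksFun r.sum_blocksFun
  exact LinearMap.congr_fun₂ h x y

/-- Only the identity is increasing on a single block. A weak composition with the single entry `n`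
also covers `n = 0`, where it stands for the empty composition; `Delta_one` needs this case when `s
= n`. -/
theorem one_eq_desElem (O : Type*) [CommRing O] (n : ℕ) :
    (1 : Des O n) = desElem O n (fun _ : Unit => n) := by
  classical
  apply Subtype.ext
  refine (?_ : _ = wordSum O (fun _ : Fin n => ())).trans
    ((coe_desElem_content O (m := fun _ => ()) monotone_const).symm.trans
      (congrArg (fun a => (desElem O n a : SymAlgebra O n)) (funext fun j => ?_)))
  swap
  · simp [content]
  rw [wordSum]
  simp only [one_eq_sum_fibInc, Finset.filter_eq', Finset.mem_univ, if_true,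
    Finset.sum_singleton, op_one, map_one]
  rfl

theorem Delta_one (O : Type*) [CommRing O] {n s : ℕ} (hs : 1 ≤ s) (hsn : s ≤ n) :
    Delta O n s 1 = 1 := by
  rw [one_eq_desElem, Delta_desElem O hs (by simp), one_eq_desElem, Finset.sum_filter]
  simp only [Finset.univ_unique, Finset.sum_singleton, hsn, if_true]
  congr 1

/-! ### The filtration by the number of parts -/

/-- The span of the `Ξ^q` for the compositions `q` with at least `k` parts. -/
noncomputable def longer (O : Type*) [CommRing O] (n k : ℕ) : Submodule O (Des O n) :=
  Submodule.span O (desBasis O n '' {q | k ≤ q.length})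

theorem repr_eq_zero_of_mem_longer {O : Type*} [CommRing O] {n k : ℕ} {x : Des O n}
    (hx : x ∈ longer O n k) {q : Composition n} (hq : q.length < k) :
    (desBasis O n).repr x q = 0 := by
  rw [longer, Module.Basis.mem_span_image] at hx
  by_contra h
  exact hq.not_ge (hx (Finsupp.mem_support_iff.2 h))

theorem longer_zero (O : Type*) [CommRing O] (n : ℕ) : longer O n 0 = ⊤ := by
  rw [longer, ← (desBasis O n).span_eq]
  simp

theorem longer_eq_bot (O : Type*) [CommRing O] {n k : ℕ} (hk : n < k) : longer O n k = ⊥ := by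
  rw [longer, Submodule.span_eq_bot]
  rintro _ ⟨q, hq, rfl⟩
  exact absurd (hk.trans_le hq) q.length_le.not_gt

theorem desElem_mem_longer {O : Type*} [CommRing O] {n k : ℕ} {α : Type*} [Fintype α]
    [LinearOrder α] {a : α → ℕ} (h : k ≤ (Finset.univ.filter fun j => 0 < a j).card) :
    desElem O n a ∈ longer O n k := by
  unfold desElem
  split_ifs with hs
  · refine Submodule.subset_span ⟨_, ?_, rfl⟩
    change k ≤ (nonzeroValues a).length
    rwa [length_nonzeroValues]
  · exact zero_mem _

theorem desElem_eq_desBasis_of_pos {O : Type*} [CommRing O] {n : ℕ} {α : Type*} [Fintype α]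
    [LinearOrder α] {a : α → ℕ} (ha : ∑ i, a i = n) (hpos : ∀ i, 0 < a i) :
    ∃ q : Composition n, q.length = Fintype.card α ∧ desElem O n a = desBasis O n q := by
  refine ⟨compOf a ha, ?_, desElem_of_sum ha⟩
  change (nonzeroValues a).length = _
  rw [length_nonzeroValues, Finset.filter_true_of_mem fun i _ => hpos i, Finset.card_univ]

theorem eq_zero_of_smul_desElem_mem_longer {O : Type*} [CommRing O] {n : ℕ} {α : Type*}
    [Fintype α] [LinearOrder α] {a : α → ℕ} (ha : ∑ i, a i = n) (hpos : ∀ i, 0 < a i) {c : O}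
    (hc : c • desElem O n a ∈ longer O n (Fintype.card α + 1)) : c = 0 := by
  obtain ⟨q, hq, h⟩ := desElem_eq_desBasis_of_pos (O := O) ha hpos
  have := repr_eq_zero_of_mem_longer hc (q := q) (by omega)
  simpa [h] using this

/-! ### Matrices with the fewest nonzero entries, and triangularity. -/

section Matrices

variable {α β : Type*} [Fintype α] [Fintype β] [LinearOrder α] [LinearOrder β]

theorem surjOn_fst_support {a : α → ℕ} {b : β → ℕ} {M : α ×ₗ β → ℕ}
    (hM : M ∈ marginMatrices a b) (hpos : ∀ i, 0 < a i) :
    Set.SurjOn (fun x : α ×ₗ β => (ofLex x).1)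
      (Finset.univ.filter fun x => 0 < M x : Finset (α ×ₗ β)) (Finset.univ : Finset α) := by
  intro i _
  rw [mem_marginMatrices] at hM
  have h : ∑ j, M (toLex (i, j)) ≠ 0 := by rw [hM.1]; exact (hpos i).ne'
  obtain ⟨j, -, hj⟩ := Finset.exists_ne_zero_of_sum_ne_zero h
  exact ⟨toLex (i, j), by simpa using Nat.pos_of_ne_zero hj, rfl⟩

theorem card_le_card_support {a : α → ℕ} {b : β → ℕ} {M : α ×ₗ β → ℕ}
    (hM : M ∈ marginMatrices a b) (hpos : ∀ i, 0 < a i) :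
    Fintype.card α ≤ (Finset.univ.filter fun x => 0 < M x).card :=
  Finset.card_le_card_of_surjOn _ (surjOn_fst_support hM hpos)

/-- The ways of distributing the entries of `a` among the letters of `β` such that those given to
the letter `j` sum to `b j`. -/
def assignments {α β : Type*} [Fintype α] [Fintype β] [DecidableEq α] [DecidableEq β]
    (a : α → ℕ) (b : β → ℕ) : Finset (α → β) :=
  Finset.univ.filter fun f => ∀ j, ∑ i with f i = j, a i = b j

theorem mem_assignments {α β : Type*} [Fintype α] [Fintype β] [DecidableEq α] [DecidableEq β]
    {a : α → ℕ} {b : β → ℕ} {f : α → β} :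
    f ∈ assignments a b ↔ ∀ j, ∑ i with f i = j, a i = b j := by
  simp [assignments]

/-- The matrix with a single nonzero entry `a i` in row `i`, at position `f i`. -/
def assignmentMatrix {α β : Type*} [LinearOrder β] (a : α → ℕ) (f : α → β) : α ×ₗ β → ℕ :=
  fun x => if f (ofLex x).1 = (ofLex x).2 then a (ofLex x).1 else 0

theorem assignmentMatrix_apply {α β : Type*} [LinearOrder β] (a : α → ℕ) (f : α → β)
    (i : α) (j : β) :
    assignmentMatrix a f (toLex (i, j)) = if f i = j then a i else 0 := rfl

theorem assignmentMatrix_mem {a : α → ℕ} {b : β → ℕ} {f : α → β} :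
    assignmentMatrix a f ∈ marginMatrices a b ↔ f ∈ assignments a b := by
  simp [mem_marginMatrices, mem_assignments, assignmentMatrix_apply, Finset.sum_filter]

theorem assignmentMatrix_injective {α β : Type*} [LinearOrder β] {a : α → ℕ} (hpos : ∀ i, 0 < a i) :
    Function.Injective (assignmentMatrix (β := β) a) := by
  intro f f' h
  funext i
  have := congrFun h (toLex (i, f i))
  simp only [assignmentMatrix_apply, if_true] at this
  by_contra hne
  rw [if_neg fun e => hne e.symm] at this
  exact (hpos i).ne' this

/-- The rows come first in the lexicographic order and each has one entry to offer, so reading the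
matrix returns `a`, whatever the columns are. -/
theorem desElem_assignmentMatrix (O : Type*) [CommRing O] (n : ℕ) (a : α → ℕ) (f : α → β) :
    desElem O n (assignmentMatrix a f) = desElem O n a := by
  refine desElem_congr (nonzeroValues_eq_of_strictMono (f := fun i => toLex (i, f i)) ?_ ?_ ?_)
  · exact fun i j hij => Prod.Lex.lt_iff.2 (Or.inl hij)
  · simp [assignmentMatrix_apply]
  · intro x hx
    refine if_neg fun h => hx ⟨(ofLex x).1, ?_⟩
    exact ofLex_inj.1 (Prod.ext rfl h)

/-- The equality case of `card_le_card_support`: the projection of the support onto the rows is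
surjective, so by counting it is injective and each row has a single nonzero entry, equal to the row
sum. -/
theorem exists_eq_assignmentMatrix {a : α → ℕ} {b : β → ℕ} {M : α ×ₗ β → ℕ}
    (hM : M ∈ marginMatrices a b) (hpos : ∀ i, 0 < a i)
    (hcard : (Finset.univ.filter fun x => 0 < M x).card ≤ Fintype.card α) :
    ∃ f, M = assignmentMatrix a f := by
  have hsurj := surjOn_fst_support hM hpos
  have hinj := Finset.injOn_of_surjOn_of_card_le (fun x : α ×ₗ β => (ofLex x).1)
    (fun _ _ => Finset.mem_coe.2 (Finset.mem_univ _)) hsurj hcard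
  have hex : ∀ i, ∃ j, 0 < M (toLex (i, j)) := by
    intro i
    obtain ⟨x, hx, rfl⟩ := hsurj (Finset.mem_coe.2 (Finset.mem_univ i))
    exact ⟨(ofLex x).2, by simpa using hx⟩
  choose f hf using hex
  have h0 : ∀ i j, f i ≠ j → M (toLex (i, j)) = 0 := by
    intro i j hij
    by_contra h
    have := @hinj (toLex (i, f i)) (by simpa using hf i) (toLex (i, j))
      (by simpa using Nat.pos_of_ne_zero h) rfl
    exact hij (Prod.mk.inj (toLex_inj.1 this)).2
  refine ⟨f, funext fun x => ?_⟩
  obtain ⟨⟨i, j⟩, rfl⟩ := toLex.surjective x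
  rw [assignmentMatrix_apply]
  split_ifs with h
  · rw [mem_marginMatrices] at hM
    rw [← hM.1, Finset.sum_eq_single j (fun j' _ hj' => h0 i j' fun e => hj' (e.symm.trans h))
      (by simp)]
  · exact h0 i j h

/-- Left multiplication by `Ξ^a` is triangular. -/
theorem desElem_mul_sub_mem_longer (O : Type*) [CommRing O] {n : ℕ} {a : α → ℕ} {b : β → ℕ}
    (ha : ∑ i, a i = n) (hb : ∑ j, b j = n) (hpos : ∀ i, 0 < a i) :
    desElem O n a * desElem O n b - ((assignments a b).card : O) • desElem O n a ∈
      longer O n (Fintype.card α + 1) := by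
  classical
  have h1 : ((assignments a b).card : O) • desElem O n a =
      ∑ M ∈ (assignments a b).image (assignmentMatrix a), desElem O n M := by
    rw [Finset.sum_image fun f _ f' _ h => assignmentMatrix_injective hpos h]
    simp only [desElem_assignmentMatrix, Finset.sum_const]
    rw [Nat.cast_smul_eq_nsmul]
  have hsub : (assignments a b).image (assignmentMatrix a) ⊆ marginMatrices a b := by
    intro M hM
    obtain ⟨f, hf, rfl⟩ := Finset.mem_image.1 hM
    exact assignmentMatrix_mem.2 hf
  rw [desElem_mul_desElem O ha hb, h1, ← Finset.sum_sdiff hsub, add_sub_cancel_right]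
  -- The assignment matrices cancel against the multiple of `Ξ^a`; any remaining matrix has more
  -- nonzero entries than there are rows.
  refine Submodule.sum_mem _ fun M hM => desElem_mem_longer ?_
  rw [Finset.mem_sdiff] at hM
  by_contra hc
  obtain ⟨f, rfl⟩ := exists_eq_assignmentMatrix hM.1 hpos (by omega)
  exact hM.2 (Finset.mem_image_of_mem _ (assignmentMatrix_mem.1 hM.1))

end Matrices

/-- The filtration consists of right ideals: the rows of a matrix in the product formula are indexed
by the parts of the left factor, and each contains a nonzero entry. -/
theorem longer_mul_mem {O : Type*} [CommRing O] {n k : ℕ} {x : Des O n} (hx : x ∈ longer O n k)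
    (y : Des O n) : x * y ∈ longer O n k := by
  have hy : y ∈ Submodule.span O (Set.range (desBasis O n)) := by
    rw [(desBasis O n).span_eq]; trivial
  unfold longer at hx
  induction hx using Submodule.span_induction with
  | zero => rw [zero_mul]; exact zero_mem _
  | add a b _ _ ha hb => rw [add_mul]; exact add_mem ha hb
  | smul c a _ ha => rw [smul_mul_assoc]; exact Submodule.smul_mem _ _ ha
  | mem x hx =>
    obtain ⟨q, hq, rfl⟩ := hx
    induction hy using Submodule.span_induction with
    | zero => rw [mul_zero]; exact zero_mem _
    | add a b _ _ ha hb => rw [mul_add]; exact add_mem ha hb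
    | smul c a _ ha => rw [mul_smul_comm]; exact Submodule.smul_mem _ _ ha
    | mem y hy =>
      obtain ⟨r, rfl⟩ := hy
      rw [← desElem_blocksFun, ← desElem_blocksFun,
        desElem_mul_desElem O q.sum_blocksFun r.sum_blocksFun]
      refine Submodule.sum_mem _ fun M hM => desElem_mem_longer ?_
      have h := card_le_card_support hM fun i => q.one_le_blocksFun i
      rw [Fintype.card_fin] at h
      exact le_trans hq h

/-! ### Cycle words and Young characters -/

/-- The fibres of the surjective word `π` are the cycles of `σ`. -/
def IsCycleWord {ι α : Type*} (σ : Perm ι) (π : ι → α) : Prop :=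
  Function.Surjective π ∧ ∀ x y, σ.SameCycle x y ↔ π x = π y

theorem exists_isCycleWord {ι : Type*} [Finite ι] (σ : Perm ι) :
    ∃ (k : ℕ) (π : ι → Fin k), IsCycleWord σ π := by
  obtain ⟨k, ⟨e⟩⟩ := Finite.exists_equiv_fin (Quotient (Perm.SameCycle.setoid σ))
  refine ⟨k, fun x => e (Quotient.mk _ x), e.surjective.comp Quotient.mk_surjective, ?_⟩
  intro x y
  rw [e.injective.eq_iff, Quotient.eq]
  rfl

/-- A cyclic permutation of each fibre is chosen, and these are glued along `π`. Applied to
`q.index`, this realises every composition as a list of cycle lengths. -/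
theorem exists_perm_isCycleWord {ι α : Type*} [Fintype ι] [DecidableEq α] {π : ι → α}
    (hπ : Function.Surjective π) : ∃ σ : Perm ι, IsCycleWord σ π := by
  classical
  have hex : ∀ i, ∃ f : Perm ι, f.IsCycleOn (Finset.univ.filter fun x => π x = i : Finset ι) :=
    fun i => (Finset.exists_cycleOn (Finset.univ.filter fun x => π x = i)).imp fun _ h => h.1
  choose f hf using hex
  have hmaps : ∀ x, π (f (π x) x) = π x := by
    intro x
    have := (hf (π x)).1.mapsTo (x := x) (by simp)
    simpa using this
  let F : ι → ι := fun x => f (π x) x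
  have hF : Function.Injective F := by
    intro x y hxy
    have h1 : π x = π y := by rw [← hmaps x, ← hmaps y]; exact congrArg π hxy
    have h2 : f (π x) x = f (π y) y := hxy
    rw [h1] at h2
    exact (f (π y)).injective h2
  let σ : Perm ι := Equiv.ofBijective F (Finite.injective_iff_bijective.1 hF)
  have hσ : ∀ x, π (σ x) = π x := hmaps
  have hpow : ∀ (k : ℕ) x, (σ ^ k) x = (f (π x) ^ k) x ∧ π ((σ ^ k) x) = π x := by
    intro k x
    induction k with
    | zero => simp
    | succ k ih =>
      rw [pow_succ', pow_succ', Perm.mul_apply, Perm.mul_apply, hσ, ih.2]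
      refine ⟨?_, rfl⟩
      rw [← ih.1]
      change f (π ((σ ^ k) x)) _ = _
      rw [ih.2]
  refine ⟨σ, hπ, fun x y => ⟨fun h => ?_, fun h => ?_⟩⟩
  · obtain ⟨k, -, rfl⟩ := h.exists_pow_eq'
    exact (hpow k x).2.symm
  · obtain ⟨k, -, hk⟩ := (hf (π x)).exists_pow_eq (a := x) (b := y) (by simp) (by simp [h])
    exact ⟨k, by rw [zpow_natCast, (hpow k x).1, hk]⟩

theorem eq_of_sameCycle {ι β : Type*} {σ : Perm ι} {u : ι → β}
    (hu : ∀ x, u (σ x) = u x) {x y : ι} (h : σ.SameCycle x y) : u x = u y := by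
  obtain ⟨k, rfl⟩ := h
  induction k with
  | zero => rfl
  | succ i ih => rw [add_comm, zpow_add, zpow_one, Perm.mul_apply, hu]; exact ih
  | pred i ih =>
    rw [ih, ← hu ((σ ^ (-(i : ℤ) - 1)) x), ← Perm.mul_apply, ← zpow_one_add]
    congr 3
    ring

/-- An assignment is a colouring of the cycles; composing it with `π` gives the induced colouring of
the points. -/
theorem mem_assignments_content {ι α β : Type*} [Fintype ι] [Fintype α] [Fintype β]
    [DecidableEq α] [DecidableEq β] {π : ι → α} {b : β → ℕ} {f : α → β} :
    f ∈ assignments (content π) b ↔ content (f ∘ π) = b := by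
  rw [mem_assignments, funext_iff]
  simp only [content_comp]

/-- The coset of `h` corresponds to the word `q.index ∘ h⁻¹`, an arbitrary word with content
`q.blocksFun`. The coset is fixed by `σ` exactly when this word is constant on the cycles of `σ`,
that is, when it factors through `π`. -/
theorem youngChar_eq {n : ℕ} (q : Composition n) {σ : Perm (Fin n)} {α : Type*} [Fintype α]
    [DecidableEq α] {π : Fin n → α} (hπ : IsCycleWord σ π) :
    youngChar q σ = (assignments (content π) q.blocksFun).card := by
  have hex : ∀ f : assignments (content π) q.blocksFun,
      ∃ g : Perm (Fin n), f.1 ∘ π = q.index ∘ g := fun f => by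
    refine exists_perm_of_content_eq ?_
    rw [mem_assignments_content.1 f.2, content_index]
  choose g hg using hex
  have hg' : ∀ f x, q.index (g f x) = f.1 (π x) := fun f x => (congrFun (hg f) x).symm
  have hπσ : ∀ x, π (σ⁻¹ x) = π x := fun x => by
    rw [← hπ.2]
    exact ⟨1, by simp⟩
  have hfix : ∀ f, (((g f)⁻¹ : Perm (Fin n)) : Perm (Fin n) ⧸ youngSubgroup q) ∈
      MulAction.fixedBy (Perm (Fin n) ⧸ youngSubgroup q) σ := by
    intro f
    rw [MulAction.mem_fixedBy]
    change ((σ * (g f)⁻¹ : Perm (Fin n)) : Perm (Fin n) ⧸ youngSubgroup q) = ((g f)⁻¹ : Perm (Fin n))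
    rw [QuotientGroup.eq]
    intro i
    simp only [mul_inv_rev, inv_inv, Perm.mul_apply]
    rw [hg', hπσ, ← hg', ← Perm.mul_apply, mul_inv_cancel, Perm.one_apply]
  rw [youngChar, ← Fintype.card_coe, ← Nat.card_eq_fintype_card]
  refine (Nat.card_eq_of_bijective (fun f => ⟨_, hfix f⟩) ⟨?_, ?_⟩).symm
  · intro f f' h
    have h1 := QuotientGroup.eq.1 (congrArg Subtype.val h)
    apply Subtype.ext
    funext i
    obtain ⟨x, rfl⟩ := hπ.1 i
    have h2 := h1 (g f' x)
    rw [inv_inv, ← Perm.mul_apply, inv_mul_cancel_right, hg', hg'] at h2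
    exact h2
  · rintro ⟨c, hc⟩
    induction c using QuotientGroup.induction_on with
    | H h =>
      rw [MulAction.mem_fixedBy] at hc
      have h1 : (σ * h)⁻¹ * h ∈ youngSubgroup q := QuotientGroup.eq.1 hc
      have hu : ∀ x, q.index (h⁻¹ (σ x)) = q.index (h⁻¹ x) := by
        intro x
        have := h1 (h⁻¹ (σ x))
        rw [mul_inv_rev] at this
        simpa using this.symm
      obtain ⟨t, ht⟩ := hπ.1.hasRightInverse
      have hf : (fun i => q.index (h⁻¹ (t i))) ∘ π = q.index ∘ (h⁻¹ : Perm (Fin n)) := by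
        funext x
        exact eq_of_sameCycle (u := fun x => q.index (h⁻¹ x)) hu ((hπ.2 _ _).2 (ht (π x)))
      refine ⟨⟨fun i => q.index (h⁻¹ (t i)), ?_⟩, ?_⟩
      · rw [mem_assignments_content, hf, content_comp_perm, content_index]
      · apply Subtype.ext
        refine QuotientGroup.eq.2 fun i => ?_
        rw [inv_inv, Perm.mul_apply, hg']
        refine (congrFun hf (h i)).trans ?_
        simp

/-! ### The map `θ` is a homomorphism of algebras with nilpotent kernel -/

theorem content_pos {ι α : Type*} [Fintype ι] [DecidableEq α] {π : ι → α}
    (hπ : Function.Surjective π) (i : α) : 0 < content π i := by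
  obtain ⟨x, rfl⟩ := hπ i
  exact Finset.card_pos.2 ⟨x, by simp⟩

theorem theta_desBasis (O : Type*) [CommRing O] {n : ℕ} (q : Composition n) (σ : Perm (Fin n)) :
    theta O n (desBasis O n q) σ = youngChar q σ := by
  rw [theta, Module.Basis.constr_basis]

section

variable {O : Type*} [CommRing O] {n : ℕ} {α : Type*} [Fintype α] [LinearOrder α]
  {σ : Perm (Fin n)} {π : Fin n → α}

theorem sum_content_fin (π : Fin n → α) : ∑ i, content π i = n := by
  rw [sum_content, Fintype.card_fin]

/-- Left multiplication by `Ξ^a` has the diagonal entries `θ(x)(σ)`, if `a` lists the cycle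
lengths of `σ`. -/
theorem desElem_mul_sub_theta_mem_longer (hπ : IsCycleWord σ π) (x : Des O n) :
    desElem O n (content π) * x - theta O n x σ • desElem O n (content π) ∈
      longer O n (Fintype.card α + 1) := by
  have hx : x ∈ Submodule.span O (Set.range (desBasis O n)) := by
    rw [(desBasis O n).span_eq]; trivial
  induction hx using Submodule.span_induction with
  | zero => simp
  | add a b _ _ ha hb =>
    rw [mul_add, map_add, Pi.add_apply, add_smul, add_sub_add_comm]
    exact add_mem ha hb
  | smul c a _ ha =>
    rw [mul_smul_comm, map_smul, Pi.smul_apply, smul_assoc, ← smul_sub]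
    exact Submodule.smul_mem _ _ ha
  | mem y hy =>
    obtain ⟨q, rfl⟩ := hy
    rw [theta_desBasis, youngChar_eq q hπ, ← desElem_blocksFun]
    exact desElem_mul_sub_mem_longer O (sum_content_fin π) q.sum_blocksFun (content_pos hπ.1)

/-- Diagonal entries are well defined: `Ξ^a` has exactly `Fintype.card α` parts, so no nonzero
multiple of it lies in the next step of the filtration. -/
theorem eq_of_sub_mem_longer (hπ : Function.Surjective π) {y : Des O n} {c d : O}
    (hc : y - c • desElem O n (content π) ∈ longer O n (Fintype.card α + 1))
    (hd : y - d • desElem O n (content π) ∈ longer O n (Fintype.card α + 1)) : c = d := by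
  have h := sub_mem hd hc
  rw [sub_sub_sub_cancel_left, ← sub_smul] at h
  exact sub_eq_zero.1 (eq_zero_of_smul_desElem_mem_longer (sum_content_fin π) (content_pos hπ) h)

theorem theta_desElem (hπ : IsCycleWord σ π) {β : Type*} [Fintype β] [LinearOrder β] {b : β → ℕ}
    (hb : ∑ j, b j = n) :
    theta O n (desElem O n b) σ = ((assignments (content π) b).card : O) :=
  eq_of_sub_mem_longer hπ.1 (desElem_mul_sub_theta_mem_longer hπ _)
    (desElem_mul_sub_mem_longer O (sum_content_fin π) hb (content_pos hπ.1))

end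

/-- Diagonal entries of triangular operators multiply. Replacing `Ξ^a x` by `θ(x)(σ) Ξ^a` is
harmless before multiplying by `y`, because the error lies in a right ideal. -/
theorem theta_mul {O : Type*} [CommRing O] {n : ℕ} (x y : Des O n) :
    theta O n (x * y) = theta O n x * theta O n y := by
  funext σ
  obtain ⟨k, π, hπ⟩ := exists_isCycleWord σ
  refine eq_of_sub_mem_longer hπ.1 (desElem_mul_sub_theta_mem_longer hπ (x * y)) ?_
  have h1 := longer_mul_mem (desElem_mul_sub_theta_mem_longer hπ x) y
  have h2 := Submodule.smul_mem _ (theta O n x σ) (desElem_mul_sub_theta_mem_longer hπ y)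
  have h3 := add_mem h1 h2
  rw [sub_mul, mul_assoc, smul_sub, smul_mul_assoc, smul_smul, sub_add_sub_cancel] at h3
  exact h3

/-- For each basis element `Ξ^q`, take a permutation whose cycles are the blocks of `q`. The
diagonal entry of `x` at `Ξ^q` is then a value of `θ(x)`, which is zero. -/
theorem mul_mem_longer_succ {O : Type*} [CommRing O] {n k : ℕ} {x y : Des O n}
    (hy : y ∈ longer O n k) (hx : theta O n x = 0) : y * x ∈ longer O n (k + 1) := by
  unfold longer at hy
  induction hy using Submodule.span_induction with
  | zero => rw [zero_mul]; exact zero_mem _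
  | add a b _ _ ha hb => rw [add_mul]; exact add_mem ha hb
  | smul c a _ ha => rw [smul_mul_assoc]; exact Submodule.smul_mem _ _ ha
  | mem y hy =>
    obtain ⟨q, hq, rfl⟩ := hy
    obtain ⟨σ, hσ⟩ := exists_perm_isCycleWord (index_surjective q)
    have h := desElem_mul_sub_theta_mem_longer hσ x
    rw [hx, Pi.zero_apply, zero_smul, sub_zero, content_index, desElem_blocksFun,
      Fintype.card_fin] at h
    exact Submodule.span_mono (Set.image_mono fun r hr =>
      (Nat.succ_le_succ hq).trans hr) h

/-- Each use of `e = e * e` moves `e` one step down the filtration, which reaches zero after `n + 1`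
steps. -/
theorem eq_zero_of_theta_eq_zero {O : Type*} [CommRing O] {n : ℕ} {e : Des O n}
    (he : IsIdempotentElem e) (h : theta O n e = 0) : e = 0 := by
  have hk : ∀ k, e ∈ longer O n k := by
    intro k
    induction k with
    | zero => rw [longer_zero]; trivial
    | succ k ih =>
      rw [← he.eq]
      exact mul_mem_longer_succ ih h
  have := hk (n + 1)
  rwa [longer_eq_bot O (Nat.lt_succ_self n), Submodule.mem_bot] at this

/-! ### `θ(x)` depends only on the `p'`-part -/

/-- The number of fixed points is the trace of the permutation matrix. Over `ZMod p` the trace of `M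
^ p` is the `p`-th power of the trace of `M`, hence the trace itself. -/
theorem natCast_card_fixedPoints_pow {X : Type*} [Finite X] {p : ℕ} [Fact p.Prime]
    (f : Perm X) : ((Function.fixedPoints (f ^ p : Perm X)).ncard : ZMod p) =
      (Function.fixedPoints f).ncard := by
  classical
  have := Fintype.ofFinite X
  have hpow : ∀ k : ℕ, (f ^ k).permMatrix (ZMod p) = (f.permMatrix (ZMod p)) ^ k := by
    intro k
    induction k with
    | zero => rw [pow_zero, pow_zero, Matrix.permMatrix_one]
    | succ k ih => rw [pow_succ, Matrix.permMatrix_mul, ih, pow_succ']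
  rw [← Matrix.trace_permutation, ← Matrix.trace_permutation, hpow, ZMod.trace_pow_card,
    ZMod.pow_card]

theorem youngChar_pow {n p : ℕ} [Fact p.Prime] (q : Composition n) (σ : Perm (Fin n)) (k : ℕ) :
    (youngChar q (σ ^ p ^ k) : ZMod p) = youngChar q σ := by
  have h1 : ∀ τ : Perm (Fin n), (youngChar q (τ ^ p) : ZMod p) = youngChar q τ := by
    intro τ
    have h := natCast_card_fixedPoints_pow (p := p)
      (MulAction.toPermHom (Perm (Fin n)) (Perm (Fin n) ⧸ youngSubgroup q) τ)
    rw [← map_pow] at h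
    exact h
  induction k with
  | zero => rw [pow_zero, pow_one]
  | succ k ih => rw [pow_succ, pow_mul, h1, ih]

theorem youngChar_congr_of_isConj {n : ℕ} (q : Composition n) {σ τ : Perm (Fin n)}
    (h : IsConj σ τ) : youngChar q σ = youngChar q τ := by
  obtain ⟨g, rfl⟩ := isConj_iff.1 h
  obtain ⟨k, π, hπ⟩ := exists_isCycleWord σ
  have hπ' : IsCycleWord (g * σ * g⁻¹) (π ∘ (g⁻¹ : Perm (Fin n))) :=
    ⟨hπ.1.comp (g⁻¹).surjective, fun x y => by rw [Perm.sameCycle_conj, hπ.2]; rfl⟩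
  rw [youngChar_eq q hπ, youngChar_eq q hπ', content_comp_perm]

theorem theta_congr {O : Type*} [CommRing O] {n : ℕ} {σ τ : Perm (Fin n)}
    (h : ∀ q : Composition n, (youngChar q σ : O) = youngChar q τ) (x : Des O n) :
    theta O n x σ = theta O n x τ := by
  have : (LinearMap.proj σ).comp (theta O n) = (LinearMap.proj τ).comp (theta O n) :=
    (desBasis O n).ext fun q => by
      simp only [LinearMap.comp_apply, LinearMap.proj_apply, theta_desBasis, h]
  exact LinearMap.congr_fun this x

/-- For `p = 0` the order of `u` is a power of zero and also positive, so the exponent is `0` and `u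
= 1`. -/
theorem IsPPrimePart.eq_of_zero {G : Type*} [Group G] [Finite G] {σ ρ : G}
    (h : IsPPrimePart 0 σ ρ) : ρ = σ := by
  obtain ⟨u, rfl, -, ⟨k, hk⟩, -⟩ := h
  have h0 := (orderOf_pos u).ne'
  have : orderOf u = 1 := by
    rcases Nat.eq_zero_or_pos k with rfl | hk0
    · simpa using hk
    · rw [zero_pow hk0.ne'] at hk
      exact absurd hk h0
  rw [orderOf_eq_one_iff.1 this, one_mul]

theorem youngChar_pPrimePart {O : Type*} [CommRing O] {n p : ℕ} [CharP O p]
    (hp : p.Prime ∨ p = 0) (q : Composition n) {σ ρ : Perm (Fin n)} (h : IsPPrimePart p σ ρ) :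
    (youngChar q σ : O) = youngChar q ρ := by
  rcases hp with hp | rfl
  · have : Fact p.Prime := ⟨hp⟩
    obtain ⟨u, hσ, hcomm, ⟨k, hk⟩, -⟩ := h
    -- Since `p ^ k` is the order of `u`, raising to this power removes `u`, and Young characters
    -- modulo `p` do not change under it.
    have h1 : σ ^ p ^ k = ρ ^ p ^ k := by
      rw [hσ, hcomm.mul_pow, ← hk, pow_orderOf_eq_one, one_mul]
    have h2 : (youngChar q σ : ZMod p) = youngChar q ρ := by
      rw [← youngChar_pow q σ k, h1, youngChar_pow]
    exact CharP.natCast_eq_natCast' O p ((ZMod.natCast_eq_natCast_iff _ _ _).1 h2)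
  · rw [h.eq_of_zero]

/-! ### `p`-equivalence of permutations and partitions -/

/-- The `p'`-parts of two permutations are conjugate. -/
def PConj (p : ℕ) {n : ℕ} (σ τ : Perm (Fin n)) : Prop :=
  ∀ ρ π : Perm (Fin n), IsPPrimePart p σ ρ → IsPPrimePart p τ π → IsConj ρ π

/-- One exponent `N` extracts the `p'`-part of every element, which turns the relation into
conjugacy of `N`-th powers and makes its transitivity evident. -/
theorem pConj_iff {p N n : ℕ} (hN : ∀ σ ρ : Perm (Fin n), IsPPrimePart p σ ρ ↔ ρ = σ ^ N)
    {σ τ : Perm (Fin n)} : PConj p σ τ ↔ IsConj (σ ^ N) (τ ^ N) := by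
  simp only [PConj, hN]
  constructor
  · exact fun h => h _ _ rfl rfl
  · rintro h _ _ rfl rfl
    exact h

section

variable {p n : ℕ}

theorem PConj.symm {σ τ : Perm (Fin n)} (h : PConj p σ τ) : PConj p τ σ :=
  fun ρ π hρ hπ => (h π ρ hπ hρ).symm

theorem PConj.trans (hp : p.Prime ∨ p = 0) {σ τ υ : Perm (Fin n)} (h : PConj p σ τ)
    (h' : PConj p τ υ) : PConj p σ υ := by
  obtain ⟨N, hN, -⟩ := exists_pPrimePart_pow hp (Perm (Fin n))
  rw [pConj_iff hN] at *
  exact h.trans h'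

theorem PConj.of_isConj (hp : p.Prime ∨ p = 0) {σ τ : Perm (Fin n)} (h : IsConj σ τ) :
    PConj p σ τ := by
  obtain ⟨N, hN, -⟩ := exists_pPrimePart_pow hp (Perm (Fin n))
  exact (pConj_iff hN).2 (h.pow N)

theorem pEquiv_iff (hp : p.Prime ∨ p = 0) {σ τ : Perm (Fin n)} {lam mu : n.Partition}
    (hσ : HasType σ lam) (hτ : HasType τ mu) : PEquiv p lam mu ↔ PConj p σ τ := by
  refine ⟨fun h ρ π hρ hπ => h σ τ ρ π hσ hτ hρ hπ, fun h σ' τ' ρ π hσ' hτ' => ?_⟩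
  exact ((PConj.of_isConj hp (hσ'.isConj hσ)).trans hp h).trans hp
    (PConj.of_isConj hp (hτ.isConj hτ')) ρ π

theorem exists_partition (σ : Perm (Fin n)) : ∃ lam : n.Partition, HasType σ lam :=
  -- `σ.partition` is a partition of `Fintype.card (Fin n)`, and has to be repackaged as one of `n`.
  ⟨⟨σ.partition.parts, σ.partition.parts_pos, by rw [σ.partition.parts_sum, Fintype.card_fin]⟩,
    rfl⟩

theorem mem_pClass_iff (hp : p.Prime ∨ p = 0) {σ τ : Perm (Fin n)} {lam : n.Partition}
    (hτ : HasType τ lam) : σ ∈ pClass p lam ↔ PConj p σ τ := by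
  constructor
  · rintro ⟨mu, h, hσ⟩
    exact (pEquiv_iff hp hσ hτ).1 h
  · intro h
    obtain ⟨mu, hσ⟩ := exists_partition σ
    exact ⟨mu, (pEquiv_iff hp hσ hτ).2 h, hσ⟩

theorem charFun_apply (O : Type*) [CommRing O] (hp : p.Prime ∨ p = 0) {σ τ : Perm (Fin n)}
    {lam : n.Partition} (hτ : HasType τ lam) [Decidable (PConj p σ τ)] :
    charFun O p lam σ = if PConj p σ τ then 1 else 0 := by
  simp only [charFun, mem_pClass_iff hp hτ]

theorem charFun_self (O : Type*) [CommRing O] (hp : p.Prime ∨ p = 0) {τ : Perm (Fin n)}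
    {lam : n.Partition} (hτ : HasType τ lam) : charFun O p lam τ = 1 := by
  classical
  rw [charFun_apply O hp hτ, if_pos (PConj.of_isConj hp (IsConj.refl _))]

theorem theta_eq_of_pConj {O : Type*} [CommRing O] [CharP O p] (hp : p.Prime ∨ p = 0)
    {σ τ : Perm (Fin n)} (h : PConj p σ τ) (x : Des O n) : theta O n x σ = theta O n x τ := by
  obtain ⟨N, hN, -⟩ := exists_pPrimePart_pow hp (Perm (Fin n))
  refine theta_congr (fun q => ?_) x
  rw [youngChar_pPrimePart hp q ((hN σ _).2 rfl), youngChar_pPrimePart hp q ((hN τ _).2 rfl),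
    youngChar_congr_of_isConj q ((pConj_iff hN).1 h)]

/-- An idempotent of the descent algebra that `θ` maps to the characteristic function of a
`p`-class is primitive. -/
theorem isPrimitiveIdempotent_of_theta_eq_charFun {F : Type*} [Field F] [CharP F p]
    (hp : p.Prime ∨ p = 0) {e : Des F n} (he : IsIdempotentElem e) {lam : n.Partition}
    (h : theta F n e = charFun F p lam) : IsPrimitiveIdempotent e := by
  classical
  obtain ⟨τ, hτ⟩ := exists_hasType lam
  have h1 : theta F n e τ = 1 := by rw [h, charFun_self F hp hτ]
  -- A summand whose image vanishes at `τ` is zero. On the class of `τ` its image is constant; off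
  -- the class the images of `a` and `b` have sum and product zero, so the square of the image of
  -- `a` is zero.
  have key : ∀ a b : Des F n, IsIdempotentElem a → a * b = 0 → e = a + b →
      theta F n a τ = 0 → a = 0 := by
    intro a b ha hab hadd h0
    refine eq_zero_of_theta_eq_zero ha (funext fun σ => ?_)
    by_cases hσ : PConj p σ τ
    · rw [theta_eq_of_pConj hp hσ, h0]; rfl
    · have h2 : theta F n a σ + theta F n b σ = 0 := by
        rw [← Pi.add_apply, ← map_add, ← hadd, h, charFun_apply F hp hτ, if_neg hσ]
      have h3 : theta F n a σ * theta F n b σ = 0 := by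
        rw [← Pi.mul_apply, ← theta_mul, hab, map_zero, Pi.zero_apply]
      rw [eq_neg_of_add_eq_zero_right h2, mul_neg, neg_eq_zero, mul_self_eq_zero] at h3
      rw [h3, Pi.zero_apply]
  refine ⟨he, ?_, fun a b ha hb hab hba hadd => ?_⟩
  · rintro rfl
    rw [map_zero] at h1
    exact zero_ne_one h1
  · have h3 : theta F n a τ * theta F n b τ = 0 := by
      rw [← Pi.mul_apply, ← theta_mul, hab, map_zero, Pi.zero_apply]
    rcases mul_eq_zero.1 h3 with h4 | h4
    · exact Or.inl (key a b ha hab hadd h4)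
    · exact Or.inr (key b a hb hba (hadd.trans (add_comm a b)) h4)

end

/-! ### Adjoining an `s`-cycle -/

section AddCycle

variable {n s : ℕ}

/-- The first `n - s` elements of `Fin n`. -/
def headEquiv (n s : ℕ) : Fin (n - s) ≃ {i : Fin n // (i : ℕ) < n - s} where
  toFun x := ⟨⟨x, by omega⟩, x.2⟩
  invFun i := ⟨i.1, i.2⟩
  left_inv _ := rfl
  right_inv _ := rfl

/-- The last `s` elements of `Fin n`. -/
def tailEquiv (hsn : s ≤ n) : Fin s ≃ {i : Fin n // ¬ (i : ℕ) < n - s} where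
  toFun x := ⟨⟨n - s + x, by omega⟩, by simp⟩
  invFun i := ⟨i.1 - (n - s), by have := i.2; omega⟩
  left_inv x := by simp
  right_inv i := by
    have := i.2
    apply Subtype.ext
    apply Fin.ext
    change n - s + ((i.1 : ℕ) - (n - s)) = i.1
    omega

/-- The permutation of `Fin n` that acts as `σ` on the first `n - s` elements and as a cycle on
the last `s` elements. -/
def addCycle (hsn : s ≤ n) (σ : Perm (Fin (n - s))) : Perm (Fin n) :=
  σ.extendDomain (headEquiv n s) * (finRotate s).extendDomain (tailEquiv hsn)

theorem disjoint_extendDomain {α β γ : Type*} {P : γ → Prop} [DecidablePred P]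
    (f : α ≃ Subtype P) (g : β ≃ Subtype fun c => ¬ P c) (σ : Perm α) (τ : Perm β) :
    Perm.Disjoint (σ.extendDomain f) (τ.extendDomain g) := by
  intro x
  by_cases h : P x
  · exact Or.inr (Perm.extendDomain_apply_not_subtype _ _ (not_not.2 h))
  · exact Or.inl (Perm.extendDomain_apply_not_subtype _ _ h)

theorem extendDomain_pow {α β : Type*} {P : β → Prop} [DecidablePred P] (f : α ≃ Subtype P)
    (σ : Perm α) (k : ℕ) : σ.extendDomain f ^ k = (σ ^ k).extendDomain f :=
  (map_pow (Perm.extendDomainHom f) σ k).symm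

theorem cycleType_addCycle_pow (hsn : s ≤ n) (σ : Perm (Fin (n - s))) (k : ℕ) :
    (addCycle hsn σ ^ k).cycleType = (σ ^ k).cycleType + ((finRotate s) ^ k).cycleType := by
  rw [addCycle, (disjoint_extendDomain _ _ _ _).commute.mul_pow, extendDomain_pow,
    extendDomain_pow, (disjoint_extendDomain _ _ _ _).cycleType_mul,
    Perm.cycleType_extendDomain, Perm.cycleType_extendDomain]

theorem IsPPrimePart.map {G H : Type*} [Group G] [Group H] {p : ℕ} {f : G →* H}
    (hf : Function.Injective f) {σ ρ : G} (h : IsPPrimePart p σ ρ) :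
    IsPPrimePart p (f σ) (f ρ) := by
  obtain ⟨u, hσ, hc, hu, hρ⟩ := h
  refine ⟨f u, by rw [hσ, map_mul], hc.map f, ?_, ?_⟩
  · rwa [orderOf_injective f hf]
  · rwa [orderOf_injective f hf]

/-- With a common exponent for both symmetric groups, the cycle type of the `p'`-part of `addCycle
hsn σ` is that of the `p'`-part of `σ` plus a contribution independent of `σ`, which cancels. -/
theorem pConj_addCycle {p : ℕ} (hp : p.Prime ∨ p = 0) (hsn : s ≤ n) {σ τ : Perm (Fin (n - s))} :
    PConj p (addCycle hsn σ) (addCycle hsn τ) ↔ PConj p σ τ := by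
  obtain ⟨N, hN, -⟩ := exists_pPrimePart_pow hp (Perm (Fin n))
  obtain ⟨K, hK, -⟩ := exists_pPrimePart_pow hp (Perm (Fin (n - s)))
  have hinj := Perm.extendDomainHom_injective (headEquiv n s)
  -- Embedding the smaller symmetric group in the larger one preserves `p'`-parts, so the exponent
  -- `N` serves for both.
  have hKN : ∀ σ : Perm (Fin (n - s)), σ ^ K = σ ^ N := by
    intro σ
    have h := (hN _ _).1 (((hK σ _).2 rfl).map hinj)
    rw [← map_pow] at h
    exact hinj h
  have hN' : ∀ σ ρ : Perm (Fin (n - s)), IsPPrimePart p σ ρ ↔ ρ = σ ^ N := fun σ ρ => by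
    rw [hK, hKN]
  rw [pConj_iff hN, pConj_iff hN', Perm.isConj_iff_cycleType_eq, Perm.isConj_iff_cycleType_eq,
    cycleType_addCycle_pow, cycleType_addCycle_pow, add_left_inj]

theorem cycleType_finRotate_eq (s : ℕ) :
    (finRotate s).cycleType = ({s} : Multiset ℕ).filter (2 ≤ ·) := by
  by_cases h : 2 ≤ s
  · rw [cycleType_finRotate_of_le h, Multiset.filter_singleton, if_pos h]
  · have : Subsingleton (Fin s) := Fin.subsingleton_iff_le_one.2 (by omega)
    rw [Subsingleton.elim (finRotate s) 1, Perm.cycleType_one, Multiset.filter_singleton, if_neg h]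
    rfl

theorem hasType_addCycle (hs : 1 ≤ s) (hsn : s ≤ n) {σ : Perm (Fin (n - s))}
    {mu : (n - s).Partition} (h : HasType σ mu) :
    HasType (addCycle hsn σ) (adjoinPart hs hsn mu) := by
  have h1 := cycleType_addCycle_pow hsn σ 1
  rw [pow_one, pow_one, pow_one] at h1
  rw [hasType_iff] at h ⊢
  rw [h1, h, cycleType_finRotate_eq, ← Multiset.filter_add, add_comm, Multiset.singleton_add]
  rfl

/-! ### Young characters at a permutation with an adjoined cycle. -/

/-- The word that labels the first `n - s` letters by `π` and the others by a new letter. -/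
def addLetter {α : Type*} (π : Fin (n - s) → α) : Fin n → Option α :=
  fun x => if h : (x : ℕ) < n - s then some (π ⟨x, h⟩) else none

theorem sameCycle_finRotate (x y : Fin s) : (finRotate s).SameCycle x y := by
  by_cases h : 2 ≤ s
  · refine (isCycle_finRotate_of_le h).sameCycle ?_ ?_ <;>
      rw [← Perm.mem_support, support_finRotate_of_le h] <;> exact Finset.mem_univ _
  · have : Subsingleton (Fin s) := Fin.subsingleton_iff_le_one.2 (by omega)
    rw [Subsingleton.elim x y]

theorem isCycleWord_addCycle (hs : 1 ≤ s) (hsn : s ≤ n) {σ : Perm (Fin (n - s))} {α : Type*}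
    {π : Fin (n - s) → α} (hπ : IsCycleWord σ π) :
    IsCycleWord (addCycle hsn σ) (addLetter π) := by
  constructor
  · rintro (_ | i)
    · exact ⟨⟨n - s, by omega⟩, dif_neg (lt_irrefl _)⟩
    · obtain ⟨x, rfl⟩ := hπ.1 i
      exact ⟨⟨x, by omega⟩, dif_pos x.2⟩
  · have hcomm := (disjoint_extendDomain (headEquiv n s) (tailEquiv hsn) σ (finRotate s)).commute
    have hfix : ∀ x : Fin (n - s), (finRotate s).extendDomain (tailEquiv hsn) (headEquiv n s x) =
        headEquiv n s x := fun x =>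
      Perm.extendDomain_apply_not_subtype _ (tailEquiv hsn) (not_not.2 (headEquiv n s x).2)
    have hfix' : ∀ x : Fin s, σ.extendDomain (headEquiv n s) (tailEquiv hsn x) =
        tailEquiv hsn x := fun x =>
      Perm.extendDomain_apply_not_subtype _ (headEquiv n s) (tailEquiv hsn x).2
    have hhead : ∀ (x : Fin (n - s)) (k : ℤ), (addCycle hsn σ ^ k) (headEquiv n s x) =
        (σ.extendDomain (headEquiv n s) ^ k) (headEquiv n s x) := by
      intro x k
      rw [addCycle, hcomm.mul_zpow, Perm.mul_apply,
        Perm.zpow_apply_eq_self_of_apply_eq_self (hfix x)]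
    have htail : ∀ (x : Fin s) (k : ℤ), (addCycle hsn σ ^ k) (tailEquiv hsn x) =
        ((finRotate s).extendDomain (tailEquiv hsn) ^ k) (tailEquiv hsn x) := by
      intro x k
      rw [addCycle, hcomm.eq, hcomm.symm.mul_zpow, Perm.mul_apply,
        Perm.zpow_apply_eq_self_of_apply_eq_self (hfix' x)]
    have hne : ∀ (x : Fin (n - s)) (y : Fin s),
        ¬ (addCycle hsn σ).SameCycle (headEquiv n s x) (tailEquiv hsn y) := by
      rintro x y ⟨k, hk⟩
      rw [hhead] at hk
      have h1 : (σ.extendDomain (headEquiv n s) ^ k) (headEquiv n s x) =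
          headEquiv n s ((σ ^ k) x) := by
        rw [← Perm.extendDomain_apply_image]
        exact congrArg (fun g : Perm (Fin n) => g (headEquiv n s x))
          (map_zpow (Perm.extendDomainHom (headEquiv n s)) σ k).symm
      have h2 := (headEquiv n s ((σ ^ k) x)).2
      rw [← h1, hk] at h2
      exact (tailEquiv hsn y).2 h2
    have hπhead : ∀ x, addLetter (n := n) (s := s) π (headEquiv n s x) = some (π x) := fun x =>
      dif_pos x.2
    have hπtail : ∀ x, addLetter (n := n) (s := s) π (tailEquiv hsn x) = none := fun x =>
      dif_neg (tailEquiv hsn x).2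
    have hcases : ∀ x : Fin n, (∃ y, x = headEquiv n s y) ∨ ∃ y, x = tailEquiv hsn y := by
      intro x
      by_cases h : (x : ℕ) < n - s
      · exact Or.inl ⟨(headEquiv n s).symm ⟨x, h⟩, by simp⟩
      · exact Or.inr ⟨(tailEquiv hsn).symm ⟨x, h⟩, by simp⟩
    intro x y
    rcases hcases x with ⟨x, rfl⟩ | ⟨x, rfl⟩ <;> rcases hcases y with ⟨y, rfl⟩ | ⟨y, rfl⟩
    · rw [hπhead, hπhead, Option.some_inj, ← hπ.2, ← Perm.sameCycle_extendDomain (f := headEquiv n s)]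
      simp only [Perm.SameCycle, hhead]
    · rw [hπhead, hπtail]
      simpa using hne x y
    · rw [hπhead, hπtail, Perm.sameCycle_comm]
      simpa using hne y x
    · rw [hπtail, hπtail, eq_self_iff_true, iff_true]
      obtain ⟨k, hk⟩ := Perm.sameCycle_extendDomain (f := tailEquiv hsn) |>.2
        (sameCycle_finRotate x y)
      exact ⟨k, by rw [htail, hk]⟩

theorem content_addLetter_some {α : Type*} [Fintype α] [DecidableEq α] (π : Fin (n - s) → α)
    (i : α) : content (addLetter (n := n) (s := s) π) (some i) = content π i := by
  symm
  refine Finset.card_bij (fun x _ => (headEquiv n s x).1) ?_ ?_ ?_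
  · intro x hx
    simp only [Finset.mem_filter, Finset.mem_univ, true_and] at hx ⊢
    rw [← hx]
    exact dif_pos x.2
  · intro x _ y _ h
    exact (headEquiv n s).injective (Subtype.ext h)
  · intro x hx
    have h1 := (Finset.mem_filter.1 hx).2
    unfold addLetter at h1
    split_ifs at h1 with h
    exact ⟨⟨x, h⟩, by simpa using h1, rfl⟩

theorem content_addLetter_none (hsn : s ≤ n) {α : Type*} [Fintype α] [DecidableEq α]
    (π : Fin (n - s) → α) : content (addLetter (n := n) (s := s) π) none = s := by
  have h1 := sum_content (addLetter (n := n) (s := s) π)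
  have h2 := sum_content π
  rw [Fintype.card_fin] at h1 h2
  rw [Fintype.sum_option] at h1
  simp only [content_addLetter_some, h2] at h1
  omega

/-- The assignments are sorted by the letter `j` given to the extra entry. That letter must have
room for it, and what remains is an assignment of `a` to the reduced content. -/
theorem card_assignments_option {α β : Type*} [Fintype α] [Fintype β] [DecidableEq α]
    [DecidableEq β] {a : α → ℕ} {a' : Option α → ℕ} (hsome : ∀ i, a' (some i) = a i)
    (b : β → ℕ) :
    (assignments a' b).card =
      ∑ j with a' none ≤ b j, (assignments a (b - Pi.single j (a' none))).card := by
  set s := a' none with hs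
  have hsum : ∀ (f : Option α → β) j, ∑ o with f o = j, a' o =
      (if f none = j then s else 0) + ∑ i with f (some i) = j, a i := by
    intro f j
    rw [Finset.sum_filter, Fintype.sum_option, Finset.sum_filter]
    simp only [hsome, hs]
  have hmem : ∀ (f : Option α → β), s ≤ b (f none) →
      (f ∈ assignments a' b ↔ f ∘ some ∈ assignments a (b - Pi.single (f none) s)) := by
    intro f hf
    rw [mem_assignments, mem_assignments]
    refine forall_congr' fun j => ?_
    rw [hsum, Pi.sub_apply, Pi.single_apply]
    simp only [Function.comp]
    by_cases h : f none = j
    · subst h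
      rw [if_pos rfl]
      omega
    · rw [if_neg h, if_neg (Ne.symm h), zero_add, tsub_zero]
  have hle : ∀ f ∈ assignments a' b, s ≤ b (f none) := by
    intro f hf
    rw [← mem_assignments.1 hf (f none), hsum, if_pos rfl]
    exact Nat.le_add_right _ _
  rw [Finset.card_eq_sum_card_fiberwise (f := fun f => f none)
    (t := Finset.univ.filter fun j => s ≤ b j) fun f hf => by simpa using hle f hf]
  refine Finset.sum_congr rfl fun j hj => ?_
  simp only [Finset.mem_filter, Finset.mem_univ, true_and] at hj
  refine Finset.card_bij' (fun f _ => f ∘ some) (fun g _ o => o.elim j g) ?_ ?_ ?_ ?_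
  · intro f hf
    rw [Finset.mem_filter] at hf
    obtain ⟨hf, rfl⟩ := hf
    exact (hmem f hj).1 hf
  · intro g hg
    rw [Finset.mem_filter]
    exact ⟨(hmem (fun o => o.elim j g) hj).2 hg, rfl⟩
  · intro f hf
    rw [Finset.mem_filter] at hf
    funext o
    cases o with
    | none => exact hf.2.symm
    | some i => rfl
  · intro g _
    rfl

/-- To colour the cycles of `addCycle hsn σ`, first choose the block `i` that receives the new
cycle, which requires `s ≤ q.blocksFun i`, then fill the rest. This choice is the sum defining
`Δ_s`. -/
theorem theta_Delta {O : Type*} [CommRing O] (hs : 1 ≤ s) (hsn : s ≤ n) (x : Des O n)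
    (σ : Perm (Fin (n - s))) :
    theta O (n - s) (Delta O n s x) σ = theta O n x (addCycle hsn σ) := by
  have h : (LinearMap.proj σ).comp ((theta O (n - s)).comp (Delta O n s)) =
      (LinearMap.proj (addCycle hsn σ)).comp (theta O n) := by
    refine (desBasis O n).ext fun q => ?_
    obtain ⟨k, π, hπ⟩ := exists_isCycleWord σ
    simp only [LinearMap.comp_apply, LinearMap.proj_apply]
    rw [theta_desBasis, youngChar_eq q (isCycleWord_addCycle hs hsn hπ),
      card_assignments_option (content_addLetter_some π), content_addLetter_none hsn,
      Delta_desBasis, map_sum, Finset.sum_apply, Nat.cast_sum]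
    refine Finset.sum_congr rfl fun i hi => ?_
    rw [Finset.mem_filter] at hi
    exact theta_desElem hπ (by rw [sum_sub_single hi.2, q.sum_blocksFun])
  exact LinearMap.congr_fun h x

end AddCycle

end DescentAlgebra

/-! ### Transfer of the idempotents along `Δ_s`. -/

theorem lemma4p8 {F : Type*} [Field F] (p : ℕ) [CharP F p] (n s : ℕ) (hs : 1 ≤ s) (hsn : s ≤ n)
    (e : DescentAlgebra.RegPartition p n → DescentAlgebra.Des F n)
    (he : DescentAlgebra.IsCompletePrimitiveOrthogonal e)
    (hθ : ∀ lam : DescentAlgebra.RegPartition p n,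
      DescentAlgebra.theta F n (e lam) = DescentAlgebra.charFun F p lam.1) :
    (∀ lam : DescentAlgebra.RegPartition p n,
      lam ∉ Set.range (DescentAlgebra.hash (CharP.char_is_prime_or_zero F p) hs hsn) →
        DescentAlgebra.Delta F n s (e lam) = 0) ∧
    DescentAlgebra.IsCompletePrimitiveOrthogonal
      (fun lam : Set.range (DescentAlgebra.hash (CharP.char_is_prime_or_zero F p) hs hsn) =>
        DescentAlgebra.Delta F n s (e lam.1)) ∧
    (∀ (lam : DescentAlgebra.RegPartition p n) (mu : DescentAlgebra.RegPartition p (n - s)),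
      DescentAlgebra.hash (CharP.char_is_prime_or_zero F p) hs hsn mu = lam →
        DescentAlgebra.theta F (n - s) (DescentAlgebra.Delta F n s (e lam)) =
          DescentAlgebra.charFun F p mu.1) := by
  classical
  open DescentAlgebra in
  have hp := CharP.char_is_prime_or_zero F p
  have hidem : ∀ lam, IsIdempotentElem (Delta F n s (e lam)) := fun lam => by
    rw [IsIdempotentElem, ← Delta_mul hs, (he.1.idem lam).eq]
  -- That `p`-equivalent regular partitions coincide is read off from the given idempotents: for
  -- `lam ≠ lam'` the product of the characteristic functions is `θ(0) = 0`, while both would be `1`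
  -- at `σ`.
  have hinj : ∀ lam lam' : RegPartition p n, PEquiv p lam.1 lam'.1 → lam = lam' := by
    intro lam lam' h
    by_contra hne
    obtain ⟨σ, hσ⟩ := exists_hasType lam.1
    obtain ⟨τ, hτ⟩ := exists_hasType lam'.1
    have h0 := congrFun (congrArg (theta F n) (he.1.ortho hne)) σ
    rw [theta_mul, map_zero, hθ, hθ, Pi.mul_apply, charFun_self F hp hσ, charFun_apply F hp hτ,
      if_pos ((pEquiv_iff hp hσ hτ).1 h), one_mul] at h0
    exact one_ne_zero h0
  have htheta : ∀ mu, theta F (n - s) (Delta F n s (e (hash hp hs hsn mu))) =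
      charFun F p mu.1 := by
    intro mu
    funext σ
    obtain ⟨τ, hτ⟩ := exists_hasType mu.1
    obtain ⟨υ, hυ⟩ := exists_hasType (hash hp hs hsn mu).1
    have h1 : PConj p υ (addCycle hsn τ) :=
      (pEquiv_iff hp hυ (hasType_addCycle hs hsn hτ)).1 (hash_spec hp hs hsn mu)
    rw [theta_Delta hs hsn, hθ, charFun_apply F hp hυ, charFun_apply F hp hτ]
    refine if_congr ?_ rfl rfl
    rw [← pConj_addCycle hp hsn]
    exact ⟨fun h => h.trans hp h1, fun h => h.trans hp h1.symm⟩
  have hzero : ∀ lam, lam ∉ Set.range (hash hp hs hsn) → Delta F n s (e lam) = 0 := by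
    intro lam hlam
    refine eq_zero_of_theta_eq_zero (hidem lam) (funext fun σ => ?_)
    obtain ⟨τ, hτ⟩ := exists_hasType lam.1
    rw [theta_Delta hs hsn, hθ, charFun_apply F hp hτ, if_neg, Pi.zero_apply]
    intro h
    obtain ⟨nu, hσ⟩ := exists_partition σ
    -- If the value at `σ` were nonzero, a regular partition `mu` that is `p`-equivalent to the
    -- cycle type of `σ` would satisfy `mu^{#s} = lam`, against the choice of `lam`.
    obtain ⟨mu, hmu, hmunu⟩ := exists_isPRegular hp nu
    obtain ⟨ρ, hρ⟩ := exists_hasType mu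
    obtain ⟨υ, hυ⟩ := exists_hasType (hash hp hs hsn ⟨mu, hmu⟩).1
    refine hlam ⟨⟨mu, hmu⟩, hinj _ _ ((pEquiv_iff hp hυ hτ).2 ?_)⟩
    have h1 : PConj p υ (addCycle hsn ρ) :=
      (pEquiv_iff hp hυ (hasType_addCycle hs hsn hρ)).1 (hash_spec hp hs hsn ⟨mu, hmu⟩)
    have h2 : PConj p ρ σ := (pEquiv_iff hp hρ hσ).1 hmunu
    exact (h1.trans hp ((pConj_addCycle hp hsn).2 h2)).trans hp h
  refine ⟨hzero, ⟨⟨⟨fun lam => hidem lam.1, ?_⟩, ?_⟩, ?_⟩, ?_⟩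
  · intro lam lam' hne
    rw [← Delta_mul hs, he.1.ortho fun h => hne (Subtype.ext h), map_zero]
  -- Applying `Δ_s` to `∑ e_λ = 1` gives a sum over all regular partitions, whose terms outside `Υ`
  -- vanish by `hzero`.
  · rw [← Delta_one F hs hsn, ← he.1.complete, map_sum,
      ← Finset.sum_subset (Finset.subset_univ (Set.range (hash hp hs hsn)).toFinset)
        fun lam _ h => hzero lam fun h' => h (Set.mem_toFinset.2 h')]
    exact (Finset.sum_subtype _ (fun _ => Set.mem_toFinset) fun lam => Delta F n s (e lam)).symm
  · rintro ⟨_, mu, rfl⟩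
    exact isPrimitiveIdempotent_of_theta_eq_charFun hp (hidem _) (htheta mu)
  · rintro _ mu rfl
    exact htheta mu
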